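/- Let $N$ be a finite set and let $\mathcal I\subseteq 2^N$ be an independence system (it contains $\emptyset$ and is closed under taking subsets), and let $p\ge 2$ and $q\ge 1$ be integers. Assume that one of the following two cases holds. (i) $\mathcal I$ is a $p$-matroid intersection, that is, $\mathcal I=\bigcap_{i=1}^p\mathcal I_i$ for the independent-set families $\mathcal I_i$ of $p$ matroids on $N$. Put $t=2p(q+1)$, and for $S\in\mathcal I$ let $\mathcal F_q(S)$ be the family of all $S'\in\mathcal I$ with $|S'\setminus S|\le 2q$ and $|S\setminus S'|\le 2pq$. (ii) $\mathcal I$ is a $p$-exchange system, that is, for all $S,S'\in\mathcal I$ there is a map $\varphi\colon S'\setminus S\to 2^{S\setminus S'}$ such that $|\varphi(v)|\le p$ for every $v\in S'\setminus S$, each $u\in S\setminus S'$ lies in $\varphi(v)$ for at most $p$ elements $v$, and $(S\setminus\bigcup_{v\in Y}\varphi(v))\cup Y\in\mathcal I$ for every $Y\subseteq S'\setminus S$. Put $t=pq+1$, and for $S\in\mathcal I$ let $\mathcal F_q(S)$ be the family of all $S'\in\mathcal I$ with $|S'\setminus S|\le q$ and $|S\setminus S'|\le pq-q+1$. Let $s=\max\{|X|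 : X\in\mathcal I\}$. Let $f\colon 2^N\to\mathbb R_{\ge 0}$ be monotone and $(\alpha,\beta_1,\beta_2)$-localizable with size $s$ and exchange size $t$, where $\alpha,\beta_1,\beta_2\ge 0$. This means: for all $X,X^*\subseteq N$ of size at most $s$, every finite multiset $\mathcal P$ of subsets of $X\triangle X^*$, each of size at most $t$, and all integers $1\le k\le \ell$ such that each element of $X^*\setminus X$ lies in at least $k$ members of $\mathcal P$ and each element of $X\setminus X^*$ lies in at most $\ell$ members of $\mathcal P$ (counted with multiplicity), $$\sum_{P\in\mathcal P}\bigl(f(X\triangle P)-f(X)\bigr)\ \ge\ \alpha k f(X^*)-(\beta_1\ell+\beta_2 k)f(X).$$ Consider local search that starts from any $X_0\in\mathcal I$ (for instance $\emptyset$) and performs at most $T$ iterations. In each iteration it picks any $X'\in\operatorname{argmax}_{Y\in\mathcal F_q(X)}f(Y)$ for the current solution $X$. If $f(X')>f(X)$ it replaces $X$ by $X'$, and otherwise it stops and returns $X$. After $T$ iterations it returns the current solution. Let $X^*$ maximize $f$ over $\mathcal I$, and put $D=\beta_1\left(p-1+\frac1q\right)+\beta_2$. Then for every $T\ge 0$ every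 possible output $X$ satisfies $$f(X)\ \ge\ \frac{\alpha\left(1-\exp\left(-\frac{D\,T}{s}\right)\right)}{D}\,f(X^*),$$ and if the algorithm stopped because it found no better set in $\mathcal F_q(X)$, then $$f(X)\ \ge\ \frac{\alpha}{D}\,f(X^*).$$ (In the degenerate cases $D=0$ or $s=0$, a quotient with denominator $0$ is read as $0$.) -/

import Mathlib

open scoped symmDiff

/-- An independence system on the finite ground set `N`, given by its family of
independent sets: it contains `∅` and is closed under taking subsets. -/
structure IsIndependenceSystem {N : Type*} (I : Set (Finset N)) : Prop where
  empty_mem : ∅ ∈ I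
  subset_mem : ∀ ⦃X Y : Finset N⦄, X ⊆ Y → Y ∈ I → X ∈ I

/-- `I` is the intersection of the independent-set families of `p` matroids on `N`. -/
def IsMatroidIntersection {N : Type*} (p : ℕ) (I : Set (Finset N)) : Prop :=
  IsIndependenceSystem I ∧
    ∃ M : Fin p → Matroid N, (∀ i, (M i).E = Set.univ) ∧
      ∀ X : Finset N, X ∈ I ↔ ∀ i, (M i).Indep (X : Set N)

/-- `I` is a `p`-exchange system. Only the values of `φ` on `T \ S` matter. -/
def IsExchangeSystem {N : Type*} [DecidableEq N] (p : ℕ) (I : Set (Finset N)) : Prop :=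
  IsIndependenceSystem I ∧
    ∀ S ∈ I, ∀ T ∈ I, ∃ φ : N → Finset N,
      (∀ v ∈ T \ S, φ v ⊆ S \ T ∧ (φ v).card ≤ p) ∧
      (∀ u ∈ S \ T, ((T \ S).filter (fun v => u ∈ φ v)).card ≤ p) ∧
      ∀ Y ⊆ T \ S, (S \ Y.biUnion φ) ∪ Y ∈ I

/-- The sets that are `q`-reachable from `S`, for a `p`-matroid intersection `I`. -/
def intersectionReachable {N : Type*} [DecidableEq N] (p q : ℕ) (I : Set (Finset N))
    (S : Finset N) : Set (Finset N) :=
  {T | T ∈ I ∧ (T \ S).card ≤ 2 * q ∧ (S \ T).card ≤ 2 * p * q}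

/-- The sets that are `q`-reachable from `S`, for a `p`-exchange system `I`; the last condition
is `|S \ T| ≤ p q - q + 1`, written without subtraction of natural numbers. -/
def exchangeReachable {N : Type*} [DecidableEq N] (p q : ℕ) (I : Set (Finset N))
    (S : Finset N) : Set (Finset N) :=
  {T | T ∈ I ∧ (T \ S).card ≤ q ∧ (S \ T).card + q ≤ p * q + 1}

/-- `f` is `(α, β₁, β₂)`-localizable with size `s` and exchange size `t`. The collection `C` may
contain repetitions. The multiplicities range over `1 ≤ k ≤ ℓ`: without `k ≤ ℓ` the inequality
would fail for nonzero linear functions with `(α, β₁, β₂) = (1, 1, 0)`, already for `X = Xopt`,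
`C = ∅`, `k = 2`, `ℓ = 1`. As a hypothesis on `f`, this is implied by the version in which `k` and
`ℓ` are arbitrary positive integers. -/
def IsLocalizable {N : Type*} [DecidableEq N] (f : Finset N → ℝ) (α β₁ β₂ : ℝ) (s t : ℕ) : Prop :=
  ∀ X Xopt : Finset N, X.card ≤ s → Xopt.card ≤ s →
    ∀ C : Multiset (Finset N), (∀ P ∈ C, P ⊆ X ∆ Xopt ∧ P.card ≤ t) →
      ∀ k ℓ : ℕ, 1 ≤ k → k ≤ ℓ →
        (∀ v ∈ Xopt \ X, k ≤ C.countP (fun P => v ∈ P)) →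
        (∀ v ∈ X \ Xopt, C.countP (fun P => v ∈ P) ≤ ℓ) →
        α * k * f Xopt - (β₁ * ℓ + β₂ * k) * f X ≤ (C.map (fun P => f (X ∆ P) - f X)).sum

/-- `X'` maximizes `f` over the family `F`. -/
def IsMaximizer {N : Type*} (f : Finset N → ℝ) (F : Set (Finset N)) (X' : Finset N) : Prop :=
  X' ∈ F ∧ ∀ Y ∈ F, f Y ≤ f X'

/-- Why local search has returned its current solution. -/
inductive SearchExit
  | iterationLimit
  | noImprovement

/-- `LocalSearch f F T X₀ X e`: local search for `f` with neighbourhoods `F`, run from the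
solution `X₀` for at most `T` iterations, can return `X` for the reason `e`. Each iteration picks
an arbitrary maximizer `X'` of `f` over the neighbourhood of the current solution, moves to `X'` if
this strictly increases `f`, and otherwise returns the current solution. -/
inductive LocalSearch {N : Type*} (f : Finset N → ℝ) (F : Finset N → Set (Finset N)) :
    ℕ → Finset N → Finset N → SearchExit → Prop
  | limit (X : Finset N) : LocalSearch f F 0 X X SearchExit.iterationLimit
  | update (T : ℕ) (X X' Y : Finset N) (e : SearchExit) (hmax : IsMaximizer f (F X) X')
      (hlt : 0 < f X' - f X) (hrest : LocalSearch f F T X' Y e) : LocalSearch f F (T + 1) X Y e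
  | halt (T : ℕ) (X X' : Finset N) (hmax : IsMaximizer f (F X) X')
      (hle : ¬ 0 < f X' - f X) : LocalSearch f F (T + 1) X X SearchExit.noImprovement

/-! The gain of one iteration is bounded by averaging. Suppose feasible exchanges from the current
solution `A` towards the optimum `B` add every element of `B \ A` exactly `k` times and remove every
element of `A \ B` at most `l` times. Localizability bounds their total gain from below by `α k f(B)
- (β₁ l + β₂ k) f(A)`. At most `k s` of them add anything, so with `l / k = p - 1 + 1/q` the best
neighbour gains at least `(α f(B) - D f(A)) / s`. Hence a positive gap `α f(B) - D f(A)` shrinks by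
a factor of at most `exp(-D/s)` per iteration, and at a local optimum the gap is at most `0`
(`localizable_step`, `LocalSearch.gap_le`).

The combinatorial work is to reach this ratio. Elements are arranged along the cycles of a
permutation `σ` such that `x` and `σ x` force the removal of a common element, and exchanges add
windows of `q` consecutive elements. With suitable multiplicities each element lies in `q * q!`
windows, while only `q!` windows contain `σ x` but not `x`. So a shared removal is charged `(q + 1)
* q!` times instead of `2 * q * q!` (`exists_window_family`).

For exchange systems, the exchange graph is completed to a `p`-regular bipartite graph, which is a
sum of `p` permutations, and two of these yield `σ` (`exists_connected_cover`). For matroid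
intersections, perfect matchings `a` and `b` in the exchange graphs of two matroids yield `σ = b⁻¹
a`. Several single exchanges may be carried out together when the matching is unique on its vertex
set, that is, rigid (`indep_of_isRigid`), and a pair of matchings decomposes fractionally into rigid
pairs (`exists_rigid_decomposition`). The other `p - 2` matroids follow the same added sets by a
Rota-type exchange (`exists_rota_exchange`). Up to a common factor the removals amount to `(q + 1) +
(p - 2) q = p q - q + 1`. -/

set_option linter.unusedSectionVars false

/-! ### Exchange families and the convergence of local search -/

/-- A family of exchanges from `A` towards `B`: the sets `P i` lie in `A ∆ B`, have size at most
`t` and lead to members of `F`; each element of `B \ A` occurs exactly `k` times and each element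
of `A \ B` at most `l` times. -/
def HasExchangeFamily {N : Type*} [DecidableEq N] (F : Set (Finset N)) (t k l : ℕ)
    (A B : Finset N) : Prop :=
  ∃ (m : ℕ) (P : Fin m → Finset N),
    (∀ i, P i ⊆ A ∆ B ∧ (P i).card ≤ t ∧ A ∆ P i ∈ F) ∧
    (∀ v ∈ B \ A, (Finset.univ.filter fun i => v ∈ P i).card = k) ∧
    ∀ u ∈ A \ B, (Finset.univ.filter fun i => u ∈ P i).card ≤ l

theorem localizable_gain_bound {N : Type*} [DecidableEq N] {f : Finset N → ℝ}
    {α β₁ β₂ : ℝ} {s t k l : ℕ} (hloc : IsLocalizable f α β₁ β₂ s t) {F : Set (Finset N)}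
    {A B X' : Finset N} (hA : A.card ≤ s) (hB : B.card ≤ s) (hk : 1 ≤ k) (hkl : k ≤ l)
    (hex : HasExchangeFamily F t k l A B) (hX' : ∀ Y ∈ F, f Y ≤ f X') (hle : f A ≤ f X') :
    α * k * f B - (β₁ * l + β₂ * k) * f A ≤ k * s * (f X' - f A) := by
  obtain ⟨m, P, hP, hV, hU⟩ := hex
  -- Sets that miss `B \ A` are discarded: the multiplicities on `B \ A` are unaffected, and the
  -- number of remaining sets is at most `k * s`, whatever `m` is.
  set J : Finset (Fin m) := Finset.univ.filter fun i => (P i ∩ (B \ A)).Nonempty with hJ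
  have hcount (v : N) : (J.val.map P).countP (fun Q => v ∈ Q) = (J.filter fun i => v ∈ P i).card := by
    rw [Multiset.countP_map]; rfl
  have h := hloc A B hA hB (J.val.map P) (by
    intro Q hQ
    obtain ⟨i, -, rfl⟩ := Multiset.mem_map.1 hQ
    exact ⟨(hP i).1, (hP i).2.1⟩) k l hk hkl
    (by
      intro v hv
      rw [hcount, ← hV v hv]
      refine Finset.card_le_card fun i hi => ?_
      simp only [Finset.mem_filter, Finset.mem_univ, true_and, hJ] at hi ⊢
      exact ⟨⟨v, Finset.mem_inter.2 ⟨hi, hv⟩⟩, hi⟩)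
    (by
      intro u hu
      rw [hcount]
      refine le_trans (Finset.card_le_card fun i hi => ?_) (hU u hu)
      simp only [Finset.mem_filter, Finset.mem_univ, true_and] at hi ⊢
      exact hi.2)
  refine h.trans ?_
  rw [Multiset.map_map]
  have h1 : (Multiset.map ((fun Q => f (A ∆ Q) - f A) ∘ P) J.val).sum
      = ∑ i ∈ J, (f (A ∆ P i) - f A) := rfl
  rw [h1]
  have h2 : ∑ i ∈ J, (f (A ∆ P i) - f A) ≤ J.card * (f X' - f A) := by
    rw [← nsmul_eq_mul]
    exact Finset.sum_le_card_nsmul _ _ _ fun i _ => by linarith [hX' _ (hP i).2.2]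
  have h3 : J.card ≤ k * s := by
    calc J.card ≤ ((B \ A).biUnion fun v => Finset.univ.filter fun i => v ∈ P i).card := by
          refine Finset.card_le_card fun i hi => ?_
          obtain ⟨v, hv⟩ := (Finset.mem_filter.1 hi).2
          rw [Finset.mem_inter] at hv
          exact Finset.mem_biUnion.2 ⟨v, hv.2, by simpa using hv.1⟩
      _ ≤ (B \ A).card * k := Finset.card_biUnion_le_card_mul _ _ _ fun v hv => (hV v hv).le
      _ ≤ s * k := Nat.mul_le_mul_right _ ((Finset.card_le_card Finset.sdiff_subset).trans hB)
      _ = k * s := mul_comm _ _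
  refine h2.trans ?_
  have : (J.card : ℝ) ≤ k * s := by exact_mod_cast h3
  exact mul_le_mul_of_nonneg_right this (by linarith)

/-- Dividing the averaged bound by `q * n` turns `l / k` into `p - 1 + 1/q`. The requirement `k ≤ l`
holds because `p ≥ 2`. -/
theorem localizable_step {N : Type*} [DecidableEq N] {f : Finset N → ℝ}
    {α β₁ β₂ : ℝ} {p q s t n : ℕ} (hp : 2 ≤ p) (hq : 1 ≤ q) (hn : 0 < n)
    (hloc : IsLocalizable f α β₁ β₂ s t) {F : Set (Finset N)}
    {A B X' : Finset N} (hA : A.card ≤ s) (hB : B.card ≤ s)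
    (hex : HasExchangeFamily F t (q * n) ((p * q + 1 - q) * n) A B)
    (hX' : ∀ Y ∈ F, f Y ≤ f X') (hle : f A ≤ f X') :
    α * f B - (β₁ * ((p : ℝ) - 1 + 1 / (q : ℝ)) + β₂) * f A ≤ s * (f X' - f A) := by
  have hqp : q + q ≤ p * q := by nlinarith
  have h := localizable_gain_bound hloc hA hB (Nat.mul_pos hq hn)
    (Nat.mul_le_mul_right n (by omega)) hex hX' hle
  have hc : ((p * q + 1 - q : ℕ) : ℝ) = p * q + 1 - q := by
    rw [Nat.cast_sub (by omega)]; push_cast; ring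
  have hq0 : (0 : ℝ) < q := by exact_mod_cast hq
  have hn0 : (0 : ℝ) < n := by exact_mod_cast hn
  push_cast [hc] at h
  have hD : (q : ℝ) * ((p : ℝ) - 1 + 1 / (q : ℝ)) = p * q + 1 - q := by field_simp; ring
  rw [← hD] at h
  refine le_of_mul_le_mul_left ?_ (mul_pos hq0 hn0)
  linarith

theorem decay_step {s D g g' d : ℝ} (hs : 0 < s) (hd : 0 ≤ d)
    (hg : g ≤ s * d) (hg' : g' = g - D * d) (hD : 0 ≤ D) {c : ℝ} (hc : 0 ≤ c) (hgc : g ≤ c) :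
    g' ≤ Real.exp (-(D / s)) * c := by
  have he : 1 - D / s ≤ Real.exp (-(D / s)) := by linarith [Real.add_one_le_exp (-(D / s))]
  have hd' : g / s ≤ d := by rw [div_le_iff₀ hs]; linarith
  have h1 : g' ≤ (1 - D / s) * g := by
    have : D * (g / s) ≤ D * d := mul_le_mul_of_nonneg_left hd' hD
    have h2 : D * (g / s) = D / s * g := by ring
    linarith
  -- For `g ≤ 0` the estimate `1 - D / s ≤ exp (-(D / s))` cannot be multiplied by `g`, but then
  -- `g'` is nonpositive as well.
  rcases le_or_gt g 0 with h0 | h0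
  · have : g' ≤ 0 := by nlinarith
    exact this.trans (mul_nonneg (Real.exp_pos _).le hc)
  · calc g' ≤ (1 - D / s) * g := h1
      _ ≤ Real.exp (-(D / s)) * g := mul_le_mul_of_nonneg_right he h0.le
      _ ≤ _ := mul_le_mul_of_nonneg_left hgc (Real.exp_pos _).le

section LocalSearch

variable {N : Type*} {f : Finset N → ℝ} {F : Finset N → Set (Finset N)} {I : Set (Finset N)}

/-- The induction carries a nonnegative upper bound `b` for the gap, because the gap itself may
become negative. An early halt does no harm: the best gain is then `0`, so the gap is at most `s *
0`. -/
theorem LocalSearch.gap_le {D s c : ℝ} (hs : 0 < s) (hD : 0 ≤ D) (hFI : ∀ X ∈ I, F X ⊆ I)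
    (hstep : ∀ X ∈ I, ∀ X', IsMaximizer f (F X) X' → f X ≤ f X' → c - D * f X ≤ s * (f X' - f X))
    (hmem : ∀ X ∈ I, X ∈ F X)
    {T : ℕ} {X Y : Finset N} {e : SearchExit} (h : LocalSearch f F T X Y e) (hX : X ∈ I)
    {b : ℝ} (hb : 0 ≤ b) (hXb : c - D * f X ≤ b) :
    c - D * f Y ≤ Real.exp (-(D * T / s)) * b := by
  induction h generalizing b with
  | limit X => simpa using hXb
  | update T X X' Y e hmax hlt _ ih =>
    have h1 := hstep X hX X' hmax (by linarith)
    have h2 := decay_step (g' := c - D * f X') hs hlt.le h1 (by ring) hD hb hXb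
    refine (ih (hFI X hX hmax.1) (mul_nonneg (Real.exp_pos _).le hb) h2).trans (le_of_eq ?_)
    rw [← mul_assoc, ← Real.exp_add]
    congr 2
    push_cast
    ring
  | halt T X X' hmax hle =>
    have h0 : f X ≤ f X' := hmax.2 X (hmem X hX)
    have h1 := hstep X hX X' hmax h0
    have h2 : f X' - f X = 0 := by linarith
    rw [h2, mul_zero] at h1
    exact h1.trans (mul_nonneg (Real.exp_pos _).le hb)

theorem LocalSearch.exists_isMaximizer_of_noImprovement (hFI : ∀ X ∈ I, F X ⊆ I)
    {T : ℕ} {X Y : Finset N} {e : SearchExit} (h : LocalSearch f F T X Y e)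
    (he : e = SearchExit.noImprovement) (hX : X ∈ I) :
    Y ∈ I ∧ ∃ X', IsMaximizer f (F Y) X' ∧ f X' ≤ f Y := by
  induction h with
  | limit X => cases he
  | update T X X' Y e hmax hlt _ ih => exact ih he (hFI X hX hmax.1)
  | halt T X X' hmax hle => exact ⟨hX, X', hmax, by linarith⟩

end LocalSearch

theorem localSearch_guarantee_of_exchange {N : Type*} [DecidableEq N]
    {I : Set (Finset N)} {p q s t : ℕ} (hp : 2 ≤ p) (hq : 1 ≤ q)
    {F : Finset N → Set (Finset N)} (hFI : ∀ X ∈ I, F X ⊆ I) (hmem : ∀ X ∈ I, X ∈ F X)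
    (hs : ∀ X ∈ I, X.card ≤ s)
    (hex : ∀ A ∈ I, ∀ B ∈ I, ∃ n, 0 < n ∧
      HasExchangeFamily (F A) t (q * n) ((p * q + 1 - q) * n) A B)
    {f : Finset N → ℝ} (hnonneg : ∀ X, 0 ≤ f X)
    {α β₁ β₂ : ℝ} (hα : 0 ≤ α) (hβ₁ : 0 ≤ β₁) (hβ₂ : 0 ≤ β₂)
    (hloc : IsLocalizable f α β₁ β₂ s t)
    {X₀ : Finset N} (hX₀ : X₀ ∈ I) {Xopt : Finset N} (hopt : Xopt ∈ I) :
    (∀ (T : ℕ) (X : Finset N) (e : SearchExit), LocalSearch f F T X₀ X e →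
      α * (1 - Real.exp (-((β₁ * ((p : ℝ) - 1 + 1 / (q : ℝ)) + β₂) * (T : ℝ) / (s : ℝ)))) /
          (β₁ * ((p : ℝ) - 1 + 1 / (q : ℝ)) + β₂) * f Xopt ≤ f X) ∧
    (∀ (T : ℕ) (X : Finset N), LocalSearch f F T X₀ X SearchExit.noImprovement →
      α / (β₁ * ((p : ℝ) - 1 + 1 / (q : ℝ)) + β₂) * f Xopt ≤ f X) := by
  set D : ℝ := β₁ * ((p : ℝ) - 1 + 1 / (q : ℝ)) + β₂ with hDdef
  have hD : 0 ≤ D := by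
    have h2 : (2 : ℝ) ≤ p := by exact_mod_cast hp
    have h3 : (0 : ℝ) ≤ 1 / (q : ℝ) := by positivity
    have : 0 ≤ β₁ * ((p : ℝ) - 1 + 1 / (q : ℝ)) := mul_nonneg hβ₁ (by linarith)
    linarith
  have hstep : ∀ X ∈ I, ∀ X', IsMaximizer f (F X) X' → f X ≤ f X' →
      α * f Xopt - D * f X ≤ s * (f X' - f X) := by
    intro X hX X' hmax hle
    obtain ⟨n, hn, h⟩ := hex X hX Xopt hopt
    exact localizable_step hp hq hn hloc (hs X hX) (hs Xopt hopt) h hmax.2 hle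
  have hc : 0 ≤ α * f Xopt := mul_nonneg hα (hnonneg _)
  -- For `D = 0` both quotients are `0` by convention, and nonnegativity of `f` suffices.
  rcases hD.eq_or_lt with h0 | h0
  · rw [← h0]
    simp [hnonneg]
  constructor
  · intro T X e h
    -- For `s = 0` the exponent is read as `0`, so the factor `1 - exp 0` vanishes.
    rcases Nat.eq_zero_or_pos s with rfl | hs0
    · simp [hnonneg]
    · have h1 := h.gap_le (by exact_mod_cast hs0 : (0 : ℝ) < s) hD hFI hstep hmem hX₀ hc
        (by nlinarith [hnonneg X₀])
      rw [div_mul_eq_mul_div, div_le_iff₀ h0]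
      linarith
  · intro T X h
    obtain ⟨hX, X', hmax, hle⟩ := h.exists_isMaximizer_of_noImprovement hFI rfl hX₀
    have h1 : f X ≤ f X' := hmax.2 X (hmem X hX)
    have h2 := hstep X hX X' hmax h1
    have h3 : f X' - f X = 0 := by linarith
    rw [h3, mul_zero] at h2
    rw [div_mul_eq_mul_div, div_le_iff₀ h0]
    linarith

/-! ### Sums of permutation matrices, and windows along the cycles of a permutation -/

section Windows

variable {X : Type*} [Fintype X] [DecidableEq X]

/-- A matrix of natural numbers with all row and column sums equal to `k > 0` has a permutation in
its support. -/
theorem exists_perm_support_of_regular {k : ℕ} (hk : 0 < k) (M : X → X → ℕ)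
    (hrow : ∀ i, ∑ j, M i j = k) (hcol : ∀ j, ∑ i, M i j = k) :
    ∃ σ : Equiv.Perm X, ∀ i, 0 < M i (σ i) := by
  classical
  obtain ⟨g, hg, hgM⟩ := (Finset.all_card_le_biUnion_card_iff_exists_injective
    (fun i => Finset.univ.filter fun j => 0 < M i j)).1 (by
      intro S
      set S' := S.biUnion fun i => Finset.univ.filter fun j => 0 < M i j
      refine Nat.le_of_mul_le_mul_right ?_ hk
      -- Hall's condition by double counting: the rows in `S` have total weight `k * S.card`, all of
      -- it in the columns `S'`, which hold only `k` each.
      calc S.card * k = ∑ i ∈ S, ∑ j, M i j := by simp [hrow]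
        _ = ∑ i ∈ S, ∑ j ∈ S', M i j := by
            refine Finset.sum_congr rfl fun i hi => ?_
            refine (Finset.sum_subset (Finset.subset_univ _) fun j _ hj => ?_).symm
            by_contra h
            exact hj (Finset.mem_biUnion.2 ⟨i, hi, by simpa [Nat.pos_iff_ne_zero] using h⟩)
        _ = ∑ j ∈ S', ∑ i ∈ S, M i j := Finset.sum_comm
        _ ≤ ∑ j ∈ S', ∑ i, M i j := Finset.sum_le_sum fun j _ =>
            Finset.sum_le_sum_of_subset (Finset.subset_univ _)
        _ = S'.card * k := by simp [hcol])
  refine ⟨Equiv.ofBijective g (Finite.injective_iff_bijective.1 hg), fun i => ?_⟩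
  simpa using hgM i

/-- A matrix of natural numbers with all row and column sums equal to `k` is a sum of `k`
permutation matrices. -/
theorem exists_perms_of_regular (k : ℕ) (M : X → X → ℕ)
    (hrow : ∀ i, ∑ j, M i j = k) (hcol : ∀ j, ∑ i, M i j = k) :
    ∃ σ : Fin k → Equiv.Perm X, ∀ i j, M i j = ∑ c, if σ c i = j then 1 else 0 := by
  induction k generalizing M with
  | zero =>
    refine ⟨Fin.elim0, fun i j => ?_⟩
    have := hrow i
    rw [Finset.sum_eq_zero_iff] at this
    simpa using this j (Finset.mem_univ _)
  | succ k ih =>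
    obtain ⟨τ, hτ⟩ := exists_perm_support_of_regular k.succ_pos M hrow hcol
    have hle (i j : X) : (if τ i = j then 1 else 0) ≤ M i j := by
      split_ifs with h
      · exact h ▸ hτ i
      · exact Nat.zero_le _
    obtain ⟨σ, hσ⟩ := ih (fun i j => M i j - if τ i = j then 1 else 0)
      (by
        intro i
        rw [Finset.sum_tsub_distrib _ fun j _ => hle i j, hrow]
        simp)
      (by
        intro j
        rw [Finset.sum_tsub_distrib _ fun i _ => hle i j, hcol]
        simp [← Equiv.eq_symm_apply])
    refine ⟨Fin.cons τ σ, fun i j => ?_⟩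
    rw [Fin.sum_univ_succ]
    simp only [Fin.cons_zero, Fin.cons_succ]
    rw [← hσ i j]
    have := hle i j
    omega

/-- The `q` elements `x, σ x, …, σ^(q-1) x`. -/
def window (σ : Equiv.Perm X) (q : ℕ) (x : X) : Finset X :=
  (Finset.range q).image fun j => (σ ^ j) x

theorem mem_window {σ : Equiv.Perm X} {q : ℕ} {x y : X} :
    y ∈ window σ q x ↔ ∃ j < q, (σ ^ j) x = y := by
  simp [window]

theorem card_window_le (σ : Equiv.Perm X) (q : ℕ) (x : X) : (window σ q x).card ≤ q :=
  Finset.card_image_le.trans (Finset.card_range q).le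

/-- The multiplicity of a window starting on a cycle of length `L`. -/
def windowWeight (q L : ℕ) : ℕ := if L < q then q * (q.factorial / L) else q.factorial

theorem minimalPeriod_perm_pos (σ : Equiv.Perm X) (x : X) : 0 < Function.minimalPeriod σ x :=
  Function.minimalPeriod_pos_of_mem_periodicPts
    (Function.Injective.mem_periodicPts σ.injective x)

theorem minimalPeriod_perm_pow (σ : Equiv.Perm X) (j : ℕ) (x : X) :
    Function.minimalPeriod σ ((σ ^ j) x) = Function.minimalPeriod σ x := by
  rw [Equiv.Perm.coe_pow]
  exact Function.minimalPeriod_apply_iterate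
    (Function.Injective.mem_periodicPts σ.injective x) j

theorem card_window (σ : Equiv.Perm X) (q : ℕ) (x : X) :
    (window σ q x).card = min q (Function.minimalPeriod σ x) := by
  have hinj : Set.InjOn (fun j => (σ ^ j) x)
      (Finset.range (min q (Function.minimalPeriod σ x)) : Set ℕ) := by
    intro a ha b hb hab
    simp only [Finset.coe_range, Set.mem_Iio, lt_min_iff] at ha hb
    simp only [Equiv.Perm.coe_pow] at hab
    exact Function.iterate_injOn_Iio_minimalPeriod ha.2 hb.2 hab
  have : window σ q x = window σ (min q (Function.minimalPeriod σ x)) x := by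
    ext y
    simp only [mem_window, lt_min_iff]
    constructor
    · rintro ⟨j, hj, rfl⟩
      refine ⟨j % Function.minimalPeriod σ x, ⟨(Nat.mod_le _ _).trans_lt hj,
        Nat.mod_lt _ (minimalPeriod_perm_pos σ x)⟩, ?_⟩
      simp only [Equiv.Perm.coe_pow]
      exact Function.iterate_mod_minimalPeriod_eq
    · rintro ⟨j, hj, rfl⟩
      exact ⟨j, hj.1, rfl⟩
  rw [this, window, Finset.card_image_of_injOn hinj, Finset.card_range]

/-- On a cycle of length `L ≥ q`, the element `x` lies in the `q` windows starting at `x, σ⁻¹ x, …`,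
each of weight `q!`. On a shorter cycle all `L` windows equal the cycle, and the weight `q * (q! /
L)` compensates; the division is exact since `L ≤ q`. -/
theorem sum_windowWeight_mem (σ : Equiv.Perm X) (q : ℕ) (x : X) :
    ∑ y, (if x ∈ window σ q y then windowWeight q (Function.minimalPeriod σ y) else 0)
      = q * q.factorial := by
  have hmem (y : X) : x ∈ window σ q y ↔ y ∈ window σ⁻¹ q x := by
    simp only [mem_window]
    refine exists_congr fun j => and_congr_right fun _ => ?_
    rw [inv_pow, Equiv.Perm.inv_eq_iff_eq, eq_comm]
  have hper : Function.minimalPeriod (⇑(σ⁻¹)) x = Function.minimalPeriod σ x := by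
    rw [Function.minimalPeriod_eq_minimalPeriod_iff]
    intro n
    simp only [Function.IsPeriodicPt, Function.IsFixedPt, ← Equiv.Perm.coe_pow, inv_pow,
      Equiv.Perm.inv_eq_iff_eq]
    exact eq_comm
  rw [← Finset.sum_filter]
  have hf : (Finset.univ.filter fun y => x ∈ window σ q y) = window σ⁻¹ q x := by
    ext y; simp [hmem]
  rw [hf, Finset.sum_congr rfl (g := fun _ => windowWeight q (Function.minimalPeriod σ x)),
    Finset.sum_const, card_window, hper, smul_eq_mul, windowWeight]
  · split_ifs with h
    · have hL := minimalPeriod_perm_pos σ x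
      rw [min_eq_right h.le, mul_left_comm, Nat.mul_div_cancel' (Nat.dvd_factorial hL h.le)]
    · rw [min_eq_left (by omega)]
  · intro y hy
    rw [← hmem, mem_window] at hy
    obtain ⟨j, -, rfl⟩ := hy
    rw [minimalPeriod_perm_pow]

/-- Such a window must start at `σ x`, on a cycle of length at least `q`, so there is at most one
and its weight is `q!`. -/
theorem sum_windowWeight_enter_le (σ : Equiv.Perm X) (q : ℕ) (x : X) :
    ∑ y, (if σ x ∈ window σ q y ∧ x ∉ window σ q y then
      windowWeight q (Function.minimalPeriod σ y) else 0) ≤ q.factorial := by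
  have hstart : ∀ y, σ x ∈ window σ q y ∧ x ∉ window σ q y →
      y = σ x ∧ q ≤ Function.minimalPeriod σ y := by
    rintro y ⟨h1, h2⟩
    obtain ⟨j, hj, hjx⟩ := mem_window.1 h1
    have hj0 : j = 0 := by
      rcases j with _ | j
      · rfl
      · rw [pow_succ', Equiv.Perm.mul_apply] at hjx
        exact absurd (mem_window.2 ⟨j, by omega, σ.injective hjx⟩) h2
    subst hj0
    refine ⟨by simpa using hjx, ?_⟩
    by_contra hlt
    have hL := minimalPeriod_perm_pos σ y
    -- A window on a shorter cycle is the whole cycle, and its last element before returning to `y =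
    -- σ x` is `x`.
    refine h2 (mem_window.2 ⟨Function.minimalPeriod σ y - 1, by omega, σ.injective ?_⟩)
    rw [← Equiv.Perm.mul_apply, ← pow_succ', Nat.sub_add_cancel hL, Equiv.Perm.coe_pow,
      Function.iterate_minimalPeriod, ← hjx]
    simp
  calc _ ≤ ∑ y, (if y = σ x then q.factorial else 0) := by
        refine Finset.sum_le_sum fun y _ => ?_
        split_ifs with h h' h'
        · rw [windowWeight, if_neg (by have := (hstart y h).2; omega)]
        · exact absurd (hstart y h).1 h'
        · exact Nat.zero_le _
        · exact le_rfl
    _ = q.factorial := by simp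

/-- A family of elements with prescribed multiplicities. -/
theorem exists_fin_family_of_weight (c : X → ℕ) :
    ∃ (m : ℕ) (x₀ : Fin m → X), ∀ (p : X → Prop) [DecidablePred p],
      (Finset.univ.filter fun i => p (x₀ i)).card = ∑ y, if p y then c y else 0 := by
  let e := Fintype.equivFin (Σ y, Fin (c y))
  refine ⟨_, fun i => (e.symm i).1, fun p _ => ?_⟩
  rw [Finset.card_filter, Fintype.sum_equiv e.symm _ (fun z => if p z.1 then 1 else 0)
    (fun i => rfl), Fintype.sum_sigma]
  refine Finset.sum_congr rfl fun y _ => ?_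
  split_ifs <;> simp

theorem exists_window_family (σ : Equiv.Perm X) (q : ℕ) :
    ∃ (m : ℕ) (x₀ : Fin m → X),
      (∀ x, (Finset.univ.filter fun i => x ∈ window σ q (x₀ i)).card = q * q.factorial) ∧
      ∀ x, (Finset.univ.filter fun i =>
        σ x ∈ window σ q (x₀ i) ∧ x ∉ window σ q (x₀ i)).card ≤ q.factorial := by
  obtain ⟨m, x₀, h⟩ := exists_fin_family_of_weight
    fun y => windowWeight q (Function.minimalPeriod σ y)
  refine ⟨m, x₀, fun x => ?_, fun x => ?_⟩
  · rw [h fun y => x ∈ window σ q y, sum_windowWeight_mem]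
  · rw [h fun y => σ x ∈ window σ q y ∧ x ∉ window σ q y]
    exact sum_windowWeight_enter_le σ q x

/-- If consecutive elements share a neighbour, a window of `q` elements of degree at most `p` has
at most `p q - q + 1` neighbours. -/
theorem card_biUnion_window_le {Y : Type*} [DecidableEq Y] (σ : Equiv.Perm X) (φ : X → Finset Y)
    {p : ℕ} (hφ : ∀ x, (φ x).card ≤ p) (hσ : ∀ x, (φ x ∩ φ (σ x)).Nonempty) (q : ℕ) (x : X) :
    ((window σ q x).biUnion φ).card + q ≤ p * q + 1 := by
  induction q with
  | zero => simp [window]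
  | succ q ih =>
    have hs : (window σ (q + 1) x).biUnion φ = φ ((σ ^ q) x) ∪ (window σ q x).biUnion φ := by
      rw [window, Finset.range_add_one, Finset.image_insert, Finset.biUnion_insert, window]
    rw [hs]
    rcases q with _ | q
    · simpa [window] using hφ x
    · have h1 := Finset.card_union_add_card_inter (φ ((σ ^ (q + 1)) x))
        ((window σ (q + 1) x).biUnion φ)
      have h2 : 0 < (φ ((σ ^ (q + 1)) x) ∩ (window σ (q + 1) x).biUnion φ).card := by
        obtain ⟨y, hy⟩ := hσ ((σ ^ q) x)
        rw [Finset.mem_inter, ← Equiv.Perm.mul_apply, ← pow_succ'] at hy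
        exact Finset.card_pos.2 ⟨y, Finset.mem_inter.2 ⟨hy.2,
          Finset.mem_biUnion.2 ⟨_, mem_window.2 ⟨q, by omega, rfl⟩, hy.1⟩⟩⟩
      have h3 := hφ ((σ ^ (q + 1)) x)
      have h4 : p * (q + 1 + 1) = p * (q + 1) + p := by ring
      omega

end Windows

theorem symmDiff_union_eq {N : Type*} [DecidableEq N] {A Y Z : Finset N}
    (hY : Disjoint Y A) (hZ : Z ⊆ A) : A ∆ (Y ∪ Z) = (A \ Z) ∪ Y := by
  ext x
  have h1 : x ∈ Y → x ∉ A := fun h => Finset.disjoint_left.1 hY h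
  have h2 : x ∈ Z → x ∈ A := fun h => hZ h
  simp only [Finset.mem_symmDiff, Finset.mem_union, Finset.mem_sdiff]
  tauto

theorem union_sdiff_sdiff_eq {N : Type*} [DecidableEq N] {A Y Z : Finset N}
    (hY : Disjoint Y A) : ((A \ Z) ∪ Y) \ A = Y := by
  ext x
  have h1 : x ∈ Y → x ∉ A := fun h => Finset.disjoint_left.1 hY h
  simp only [Finset.mem_union, Finset.mem_sdiff]
  tauto

theorem sdiff_union_sdiff_eq {N : Type*} [DecidableEq N] {A Y Z : Finset N}
    (hY : Disjoint Y A) (hZ : Z ⊆ A) : A \ ((A \ Z) ∪ Y) = Z := by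
  ext x
  have h1 : x ∈ Y → x ∉ A := fun h => Finset.disjoint_left.1 hY h
  have h2 : x ∈ Z → x ∈ A := fun h => hZ h
  simp only [Finset.mem_union, Finset.mem_sdiff]
  tauto

/-! ### Connected covers in bipartite graphs, and the exchange family of an exchange system -/

section Bipartite

variable {N : Type*} [Fintype N] [DecidableEq N]

/-- The regular completion of a bipartite graph with maximum degree `p`: two copies of the graph
joined by parallel edges between the copies of each vertex. -/
def regularCompletion (p : ℕ) (E : N → N → Prop) [DecidableRel E] : N ⊕ N → N ⊕ N → ℕ
  | Sum.inl v, Sum.inl w => if v = w then p - (Finset.univ.filter fun u => E v u).card else 0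
  | Sum.inl v, Sum.inr u => if E v u then 1 else 0
  | Sum.inr u, Sum.inl v => if E v u then 1 else 0
  | Sum.inr u, Sum.inr w => if u = w then p - (Finset.univ.filter fun v => E v u).card else 0

theorem regularCompletion_symm (p : ℕ) (E : N → N → Prop) [DecidableRel E] (x y : N ⊕ N) :
    regularCompletion p E x y = regularCompletion p E y x := by
  rcases x with v | u <;> rcases y with w | z <;> simp only [regularCompletion, eq_comm]
  · split_ifs with h
    · rw [h]
    · rfl
  · split_ifs with h
    · rw [h]
    · rfl

theorem sum_regularCompletion {p : ℕ} {E : N → N → Prop} [DecidableRel E]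
    (hl : ∀ v, (Finset.univ.filter fun u => E v u).card ≤ p)
    (hr : ∀ u, (Finset.univ.filter fun v => E v u).card ≤ p) (x : N ⊕ N) :
    ∑ y, regularCompletion p E x y = p := by
  rcases x with v | u
  · rw [Fintype.sum_sum_type]
    simp only [regularCompletion, Finset.sum_ite_eq, Finset.mem_univ, if_true,
      ← Finset.card_filter]
    have := hl v
    omega
  · rw [Fintype.sum_sum_type]
    simp only [regularCompletion, Finset.sum_ite_eq, Finset.mem_univ, if_true,
      ← Finset.card_filter]
    have := hr u
    omega

/-- In a bipartite graph of maximum degree `p` there are connected sets of at most `q` left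
vertices that cover every left vertex exactly `q * q!` times and whose neighbourhoods cover every
right vertex at most `(p q - q + 1) * q!` times. -/
theorem exists_connected_cover {p : ℕ} (q : ℕ) (hp : 2 ≤ p) (E : N → N → Prop)
    [DecidableRel E]
    (hl : ∀ v, (Finset.univ.filter fun u => E v u).card ≤ p)
    (hr : ∀ u, (Finset.univ.filter fun v => E v u).card ≤ p) :
    ∃ (m : ℕ) (Y : Fin m → Finset N),
      (∀ i, (Y i).card ≤ q ∧
        ((Y i).biUnion fun v => Finset.univ.filter fun u => E v u).card + q ≤ p * q + 1) ∧
      (∀ v, (Finset.univ.filter fun i => v ∈ Y i).card = q * q.factorial) ∧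
      ∀ u, (Finset.univ.filter fun i => ∃ v ∈ Y i, E v u).card
        ≤ (p * q + 1 - q) * q.factorial := by
  obtain ⟨π, hπ⟩ := exists_perms_of_regular p (regularCompletion p E)
    (sum_regularCompletion hl hr)
    (fun y => by simp only [regularCompletion_symm p E _ y, sum_regularCompletion hl hr y])
  set c₀ : Fin p := ⟨0, by omega⟩
  set c₁ : Fin p := ⟨1, by omega⟩
  have hc : c₀ ≠ c₁ := by simp [c₀, c₁]
  have hpos (c : Fin p) (x : N ⊕ N) : 0 < regularCompletion p E x (π c x) := by
    rw [hπ]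
    exact Finset.sum_pos' (fun _ _ => Nat.zero_le _) ⟨c, Finset.mem_univ _, by simp⟩
  -- The rows `x` and `σ x` share the column `π c₀ x`, so the rows of a window form a connected set.
  set σ : Equiv.Perm (N ⊕ N) := (π c₁)⁻¹ * π c₀ with hσ
  have hσ' (x : N ⊕ N) : π c₁ (σ x) = π c₀ x := by simp [hσ]
  set Φ : N ⊕ N → Finset (N ⊕ N) := fun x =>
    Finset.univ.filter fun y => 0 < regularCompletion p E x y
  have hΦ (x : N ⊕ N) : (Φ x).card ≤ p := by
    rw [← sum_regularCompletion hl hr x, Finset.card_filter]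
    exact Finset.sum_le_sum fun y _ => by split_ifs <;> omega
  have hΦσ (x : N ⊕ N) : (Φ x ∩ Φ (σ x)).Nonempty :=
    ⟨π c₀ x, Finset.mem_inter.2 ⟨by simpa [Φ] using hpos c₀ x,
      by simpa [Φ, hσ'] using hpos c₁ (σ x)⟩⟩
  obtain ⟨m, x₀, h1, h2⟩ := exists_window_family σ q
  refine ⟨m, fun i => Finset.univ.filter fun v => Sum.inl v ∈ window σ q (x₀ i), ?_, ?_, ?_⟩
  · refine fun i => ⟨?_, ?_⟩
    · refine le_trans ?_ (card_window_le σ q (x₀ i))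
      refine Finset.card_le_card_of_injOn Sum.inl ?_ Sum.inl_injective.injOn
      intro v hv
      simpa using hv
    · refine le_trans (Nat.add_le_add_right ?_ q) (card_biUnion_window_le σ Φ hΦ hΦσ q (x₀ i))
      refine Finset.card_le_card_of_injOn Sum.inr ?_ Sum.inr_injective.injOn
      intro u hu
      simp only [Finset.coe_biUnion, Set.mem_iUnion, Finset.mem_coe, Finset.mem_filter,
        Finset.mem_univ, true_and] at hu ⊢
      obtain ⟨v, hv, hE⟩ := hu
      exact ⟨Sum.inl v, hv, by
        rw [Finset.mem_filter]
        simp [regularCompletion, hE]⟩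
  · intro v
    simpa using h1 (Sum.inl v)
  · intro u
    simp only [Finset.mem_filter, Finset.mem_univ, true_and]
    have hcover (S : Finset N) : (Finset.univ.filter fun i => ∃ v ∈ S,
        Sum.inl v ∈ window σ q (x₀ i)).card ≤ S.card * (q * q.factorial) := by
      have : (Finset.univ.filter fun i => ∃ v ∈ S, Sum.inl v ∈ window σ q (x₀ i))
          = S.biUnion fun v => Finset.univ.filter fun i => Sum.inl v ∈ window σ q (x₀ i) := by
        ext i; simp
      rw [this]
      exact Finset.card_biUnion_le_card_mul _ _ _ fun v _ => (h1 _).le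
    have hnum : (p * q + 1 - q) * q.factorial = (p - 1) * (q * q.factorial) + q.factorial := by
      have : p * q + 1 - q = (p - 1) * q + 1 := by
        rw [Nat.sub_mul, one_mul]
        have := Nat.le_mul_of_pos_left q (by omega : 0 < p)
        omega
      rw [this]; ring
    rw [hnum]
    -- Below degree `p`, counting `q * q!` windows for each of at most `p - 1` neighbours is enough.
    -- At degree `p` the column of `u` has no diagonal entry, so both `π c₀` and `π c₁` reach it
    -- from genuine neighbours `v₀` and `v₁ = σ v₀`. Then `v₁` costs only the `q!` windows that
    -- avoid `v₀`.
    rcases (hr u).lt_or_eq with hlt | heq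
    · refine le_trans (le_trans (Finset.card_le_card fun i hi => ?_)
        ((hcover (Finset.univ.filter fun v => E v u)).trans
          (Nat.mul_le_mul_right _ (by omega : _ ≤ p - 1)))) (Nat.le_add_right _ _)
      simp only [Finset.mem_filter, Finset.mem_univ, true_and] at hi ⊢
      obtain ⟨v, hv, hE⟩ := hi
      exact ⟨v, hE, hv⟩
    · have hpre (c : Fin p) : ∃ v, π c (Sum.inl v) = Sum.inr u ∧ E v u := by
        have h := hpos c ((π c).symm (Sum.inr u))
        rw [Equiv.apply_symm_apply] at h
        rcases hx : (π c).symm (Sum.inr u) with v | w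
        · rw [hx] at h
          refine ⟨v, by rw [← hx, Equiv.apply_symm_apply], ?_⟩
          by_contra hE
          simp [regularCompletion, hE] at h
        · rw [hx] at h
          simp only [regularCompletion] at h
          split_ifs at h with hw
          · subst hw; omega
          · omega
      obtain ⟨v₀, hv₀, hE₀⟩ := hpre c₀
      obtain ⟨v₁, hv₁, hE₁⟩ := hpre c₁
      have hσv : σ (Sum.inl v₀) = Sum.inl v₁ := (π c₁).injective (by rw [hσ', hv₀, hv₁])
      -- The graph is simple, so the matrix entry `1` at `(v₀, u)` is used by only one of the
      -- permutations.
      have hne : v₀ ≠ v₁ := by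
        rintro rfl
        have h := hπ (Sum.inl v₀) (Sum.inr u)
        simp only [regularCompletion, if_pos hE₀] at h
        have : ∑ c ∈ {c₀, c₁}, (if π c (Sum.inl v₀) = Sum.inr u then 1 else 0) ≤ 1 :=
          (Finset.sum_le_sum_of_subset (Finset.subset_univ _)).trans h.ge
        rw [Finset.sum_pair hc, if_pos hv₀, if_pos hv₁] at this
        omega
      set S : Finset N := (Finset.univ.filter fun v => E v u).erase v₁ with hS
      have hScard : S.card = p - 1 := by
        rw [hS, Finset.card_erase_of_mem (by simpa using hE₁), heq]
      calc _ ≤ ((Finset.univ.filter fun i => ∃ v ∈ S, Sum.inl v ∈ window σ q (x₀ i)) ∪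
            (Finset.univ.filter fun i => σ (Sum.inl v₀) ∈ window σ q (x₀ i) ∧
              Sum.inl v₀ ∉ window σ q (x₀ i))).card := by
            refine Finset.card_le_card fun i hi => ?_
            simp only [Finset.mem_union, Finset.mem_filter, Finset.mem_univ, true_and] at hi ⊢
            obtain ⟨v, hv, hE⟩ := hi
            by_cases hv1 : v = v₁
            · by_cases h0 : Sum.inl v₀ ∈ window σ q (x₀ i)
              · exact Or.inl ⟨v₀, by simp [hS, hne, hE₀], h0⟩
              · exact Or.inr ⟨by rw [hσv, ← hv1]; exact hv, h0⟩
            · exact Or.inl ⟨v, by simp [hS, hv1, hE], hv⟩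
        _ ≤ _ := Finset.card_union_le _ _
        _ ≤ _ := Nat.add_le_add ((hcover S).trans_eq (by rw [hScard])) (h2 _)

/-- The connected cover is applied to the graph joining `v` in `B \ A` to the elements of `φ v`.
Added and removed elements together number at most `q + (p q - q + 1)`, which is the exchange size.
-/
theorem IsExchangeSystem.hasExchangeFamily {p : ℕ} (q : ℕ) (hp : 2 ≤ p)
    {I : Set (Finset N)} (hI : IsExchangeSystem p I) {A B : Finset N} (hA : A ∈ I) (hB : B ∈ I) :
    HasExchangeFamily (exchangeReachable p q I A) (p * q + 1) (q * q.factorial)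
      ((p * q + 1 - q) * q.factorial) A B := by
  obtain ⟨φ, hφ1, hφ2, hφ3⟩ := hI.2 A hA B hB
  have hE (v : N) : (Finset.univ.filter fun u => v ∈ B \ A ∧ u ∈ φ v)
      = if v ∈ B \ A then φ v else ∅ := by
    split_ifs with h <;> ext u <;> simp only [Finset.mem_filter, h] <;> simp
  obtain ⟨m, Y, hY1, hY2, hY3⟩ := exists_connected_cover q hp
    (fun v u => v ∈ B \ A ∧ u ∈ φ v)
    (by
      intro v
      rw [hE]
      split_ifs with h
      · exact (hφ1 v h).2
      · simp)
    (by
      intro u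
      by_cases hu : u ∈ A \ B
      · refine le_of_eq_of_le (congrArg _ ?_) (hφ2 u hu)
        ext v
        simp
      · refine le_of_eq_of_le ?_ (Nat.zero_le p)
        rw [Finset.card_eq_zero, Finset.filter_eq_empty_iff]
        exact fun v _ h => hu ((hφ1 v h.1).1 h.2))
  set Z : Fin m → Finset N := fun i =>
    (Y i).biUnion fun v => Finset.univ.filter fun u => v ∈ B \ A ∧ u ∈ φ v with hZ
  -- The cover runs over all of `N`. Vertices outside `B \ A` are isolated, so dropping them leaves
  -- the neighbourhoods `Z i` unchanged.
  set Y' : Fin m → Finset N := fun i => Y i ∩ (B \ A) with hY'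
  have hZ' (i) : Z i = (Y' i).biUnion φ := by
    ext u
    simp only [hZ, hY', Finset.mem_biUnion, Finset.mem_filter, Finset.mem_univ, true_and,
      Finset.mem_inter]
    tauto
  have hYB (i) : Y' i ⊆ B \ A := Finset.inter_subset_right
  have hZA (i) : Z i ⊆ A \ B := by
    rw [hZ', Finset.biUnion_subset]
    exact fun v hv => (hφ1 v (hYB i hv)).1
  have hYA (i) : Disjoint (Y' i) A :=
    Finset.disjoint_of_subset_left (hYB i) Finset.sdiff_disjoint
  have hZA' (i) : Z i ⊆ A := (hZA i).trans Finset.sdiff_subset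
  have hYc (i) : (Y' i).card ≤ q := (Finset.card_le_card Finset.inter_subset_left).trans (hY1 i).1
  have hpq : q ≤ p * q := Nat.le_mul_of_pos_left q (by omega)
  refine ⟨m, fun i => Y' i ∪ Z i, fun i => ⟨?_, ?_, ?_⟩, ?_, ?_⟩
  · refine Finset.union_subset ((hYB i).trans fun x hx => ?_) ((hZA i).trans fun x hx => ?_)
    · exact Finset.mem_symmDiff.2 (Or.inr (Finset.mem_sdiff.1 hx))
    · exact Finset.mem_symmDiff.2 (Or.inl (Finset.mem_sdiff.1 hx))
  · have h1 := (hY1 i).2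
    have h2 := hYc i
    refine (Finset.card_union_le _ _).trans ?_
    simp only [hZ]
    omega
  · rw [symmDiff_union_eq (hYA i) (hZA' i)]
    refine ⟨?_, ?_, ?_⟩
    · rw [hZ']
      exact hφ3 (Y' i) (hYB i)
    · rw [union_sdiff_sdiff_eq (hYA i)]
      exact hYc i
    · rw [sdiff_union_sdiff_eq (hYA i) (hZA' i)]
      exact (hY1 i).2
  · intro v hv
    rw [← hY2 v]
    congr 1
    ext i
    have h1 : v ∉ Z i := fun h => (Finset.mem_sdiff.1 hv).2 (hZA' i h)
    simp [hY', Finset.mem_sdiff.1 hv, h1]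
  · intro u hu
    refine le_trans (Finset.card_le_card fun i hi => ?_) (hY3 u)
    have h1 : u ∉ Y' i := fun h => (Finset.mem_sdiff.1 (hYB i h)).2 (Finset.mem_sdiff.1 hu).1
    simp only [Finset.mem_filter, Finset.mem_univ, true_and, Finset.mem_union, h1, false_or, hZ,
      Finset.mem_biUnion] at hi ⊢
    exact hi

end Bipartite

/-! ### Decomposing pairs of perfect matchings into rigid ones -/

section Rigid

variable {X Y : Type*} [Fintype X] [DecidableEq X]

theorem exists_iterate_mem_periodicPts (f : X → X) (x : X) :
    ∃ n, f^[n] x ∈ Function.periodicPts f := by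
  obtain ⟨m, n, hne, h⟩ := Finite.exists_ne_map_eq_of_infinite fun n => f^[n] x
  wlog hlt : m < n generalizing m n
  · exact this n m hne.symm h.symm (by omega)
  refine ⟨m, Function.mk_mem_periodicPts (Nat.sub_pos_of_lt hlt) ?_⟩
  change f^[n - m] (f^[m] x) = f^[m] x
  rw [← Function.iterate_add_apply, Nat.sub_add_cancel hlt.le]
  exact h.symm

/-- A self-map permutes its periodic points. This extracts cycles from a choice of successors that
need not be injective. -/
theorem exists_perm_eqOn_periodicPts (f : X → X) :
    ∃ ρ : Equiv.Perm X, (∀ x ∈ Function.periodicPts f, ρ x = f x) ∧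
      ∀ x ∉ Function.periodicPts f, ρ x = x := by
  classical
  have hb := Function.bijOn_periodicPts f
  set g : X → X := fun x => if x ∈ Function.periodicPts f then f x else x with hg
  have hinj : Function.Injective g := by
    intro x y hxy
    simp only [hg] at hxy
    split_ifs at hxy with hx hy hy
    · exact hb.injOn hx hy hxy
    · exact absurd (hxy ▸ hb.mapsTo hx) hy
    · exact absurd (hxy ▸ hb.mapsTo hy) hx
    · exact hxy
  refine ⟨Equiv.ofBijective g (Finite.injective_iff_bijective.1 hinj), fun x hx => ?_,
    fun x hx => ?_⟩
  · simp [hg, hx]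
  · simp [hg, hx]

/-- `S` is a family of proper subsets, each permuted along arcs of `σ` or `σ'`, that covers every
element `n` times. -/
def SplitsInto (σ σ' : Equiv.Perm X) (n : ℕ) {m : ℕ} (S : Fin m → Finset X)
    (ρ : Fin m → Equiv.Perm X) : Prop :=
  (∀ i, S i ≠ Finset.univ) ∧ (∀ i, ∀ x ∈ S i, ρ i x ∈ S i) ∧
    (∀ i, ∀ x ∈ S i, ρ i x = σ x ∨ ρ i x = σ' x) ∧
    ∀ x, (Finset.univ.filter fun i => x ∈ S i).card = n

theorem exists_splitsInto_of_fixed {σ σ' τ : Equiv.Perm X} (hne : σ ≠ σ')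
    (hτ : ∀ x, τ x = σ x ∨ τ x = σ' x) {x₀ : X} (hx : τ x₀ = x₀) :
    ∃ (n m : ℕ) (S : Fin m → Finset X) (ρ : Fin m → Equiv.Perm X),
      0 < n ∧ SplitsInto σ σ' n S ρ := by
  refine ⟨1, 2, ![{x₀}, {x₀}ᶜ], fun _ => τ, one_pos, ?_, ?_, fun i x _ => hτ x, ?_⟩
  · intro i
    fin_cases i
    · intro h
      refine hne (Equiv.ext fun x => ?_)
      have hall (y : X) : y = x₀ := by
        have h' : ({x₀} : Finset X) = Finset.univ := h
        simpa using h'.ge (Finset.mem_univ y)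
      rw [hall (σ x), hall (σ' x)]
    · simp
  · intro i x hxS
    fin_cases i
    · change x ∈ ({x₀} : Finset X) at hxS
      change τ x ∈ ({x₀} : Finset X)
      rw [Finset.mem_singleton] at hxS ⊢
      rw [hxS, hx]
    · change x ∈ ({x₀}ᶜ : Finset X) at hxS
      change τ x ∈ ({x₀}ᶜ : Finset X)
      rw [Finset.mem_compl, Finset.mem_singleton] at hxS ⊢
      exact fun h => hxS (τ.injective (h.trans hx.symm))
  · intro x
    rw [Finset.card_filter, Fin.sum_univ_two]
    by_cases h : x = x₀ <;> simp [h]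

/-- Without fixed points, the 3-regular matrix `1 + σ + σ'` is split into three permutations whose
sets of moved points serve as the subsets. A fixed point is easier: it is separated from its
complement. -/
theorem exists_splitsInto {σ σ' : Equiv.Perm X} (hne : σ ≠ σ') :
    ∃ (n m : ℕ) (S : Fin m → Finset X) (ρ : Fin m → Equiv.Perm X),
      0 < n ∧ SplitsInto σ σ' n S ρ := by
  classical
  by_cases hfix : ∃ x, σ x = x
  · obtain ⟨x, hx⟩ := hfix
    exact exists_splitsInto_of_fixed hne (fun _ => Or.inl rfl) hx
  by_cases hfix' : ∃ x, σ' x = x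
  · obtain ⟨x, hx⟩ := hfix'
    exact exists_splitsInto_of_fixed hne (fun _ => Or.inr rfl) hx
  push Not at hfix hfix'
  obtain ⟨v, hv⟩ : ∃ v, σ v ≠ σ' v := by
    by_contra h
    push Not at h
    exact hne (Equiv.ext h)
  set f : X → X := Function.update σ v (σ' v) with hf
  have hfx (x : X) : f x = σ x ∨ f x = σ' x := by
    by_cases h : x = v
    · subst h; exact Or.inr (by simp [hf])
    · exact Or.inl (by simp [hf, h])
  have hfne (x : X) : f x ≠ x := by
    rcases hfx x with h | h <;> rw [h]
    exacts [hfix x, hfix' x]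
  obtain ⟨ρ₀, hρ₀, hρ₀'⟩ := exists_perm_eqOn_periodicPts f
  -- `ρ₀` is contained in `1 + σ + σ'`, its fixed points using the identity. The remainder is
  -- 2-regular and gives two further permutations.
  have hle (i j : X) : (if ρ₀ i = j then 1 else 0) ≤
      (if i = j then 1 else 0) + (if σ i = j then 1 else 0) + (if σ' i = j then 1 else 0) := by
    by_cases h : ρ₀ i = j
    · have : i = j ∨ σ i = j ∨ σ' i = j := by
        by_cases hi : i ∈ Function.periodicPts f
        · rw [hρ₀ i hi] at h
          rcases hfx i with h' | h'
          · exact Or.inr (Or.inl (h' ▸ h))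
          · exact Or.inr (Or.inr (h' ▸ h))
        · exact Or.inl (hρ₀' i hi ▸ h)
      rcases this with h' | h' | h' <;> simp only [h, h', if_true] <;> split_ifs <;> omega
    · simp [h]
  obtain ⟨π, hπ⟩ := exists_perms_of_regular 2 (fun i j =>
    (if i = j then 1 else 0) + (if σ i = j then 1 else 0) + (if σ' i = j then 1 else 0)
      - (if ρ₀ i = j then 1 else 0))
    (by
      intro i
      rw [Finset.sum_tsub_distrib _ fun j _ => hle i j, Finset.sum_add_distrib,
        Finset.sum_add_distrib]
      simp)
    (by
      intro j
      rw [Finset.sum_tsub_distrib _ fun i _ => hle i j, Finset.sum_add_distrib,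
        Finset.sum_add_distrib]
      simp [← Equiv.eq_symm_apply])
  set ρ : Fin 3 → Equiv.Perm X := Fin.cons ρ₀ π with hρ
  have hsum (i j : X) : (if i = j then 1 else 0) + (if σ i = j then 1 else 0)
      + (if σ' i = j then 1 else 0) = ∑ c, if ρ c i = j then 1 else 0 := by
    rw [Fin.sum_univ_succ]
    simp only [hρ, Fin.cons_zero, Fin.cons_succ]
    rw [← hπ i j]
    have := hle i j
    omega
  set S : Fin 3 → Finset X := fun c => Finset.univ.filter fun x => ρ c x ≠ x with hS
  have hmemS (c : Fin 3) (x : X) : x ∈ S c ↔ ρ c x ≠ x := by simp [hS]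
  -- Since `σ` and `σ'` have no fixed points, the diagonal entries are `1`: each `x` is fixed by
  -- exactly one of the three permutations and moved by two.
  have hcount (x : X) : (Finset.univ.filter fun c => x ∈ S c).card = 2 := by
    have h1 := hsum x x
    simp only [if_true, hfix x, hfix' x, if_false, add_zero, ← Finset.card_filter] at h1
    have h2 := Finset.card_filter_add_card_filter_not (s := (Finset.univ : Finset (Fin 3)))
      (fun c => ρ c x = x)
    simp only [hmemS]
    rw [← h1, Finset.card_univ, Fintype.card_fin] at h2
    simp only [ne_eq]
    omega
  have hinv (c : Fin 3) : ∀ x ∈ S c, ρ c x ∈ S c := by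
    intro x hx
    rw [hmemS] at hx ⊢
    exact fun h => hx ((ρ c).injective h)
  have harc (c : Fin 3) : ∀ x ∈ S c, ρ c x = σ x ∨ ρ c x = σ' x := by
    intro x hx
    rw [hmemS] at hx
    have h1 := hsum x (ρ c x)
    have h2 : 0 < ∑ c', if ρ c' x = ρ c x then 1 else 0 :=
      Finset.sum_pos' (fun _ _ => Nat.zero_le _) ⟨c, Finset.mem_univ _, by simp⟩
    rw [← h1, if_neg hx.symm] at h2
    by_contra h
    push Not at h
    rw [if_neg h.1.symm, if_neg h.2.symm] at h2
    omega
  have hS0 (x : X) : x ∈ S 0 ↔ x ∈ Function.periodicPts f := by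
    rw [hmemS]
    by_cases hx : x ∈ Function.periodicPts f
    · simp only [hx, iff_true]
      change ρ₀ x ≠ x
      rw [hρ₀ x hx]
      exact hfne x
    · simp only [hx, iff_false, not_not]
      exact hρ₀' x hx
  -- Redirecting `v` creates a collision: `v` and `σ⁻¹ (σ' v)` have the same image under `f`, so
  -- they are not both periodic.
  have hS0ne : S 0 ≠ Finset.univ := by
    intro h
    have hw : f (σ.symm (σ' v)) = f v := by
      have hwv : σ.symm (σ' v) ≠ v := fun h' => hv (by rw [← h', Equiv.apply_symm_apply, h'])
      simp [hf, hwv]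
    have hw' := (Function.bijOn_periodicPts f).injOn
      ((hS0 _).1 (h ▸ Finset.mem_univ (σ.symm (σ' v)))) ((hS0 _).1 (h ▸ Finset.mem_univ v)) hw
    exact hv (by rw [← hw', Equiv.apply_symm_apply, hw'])
  obtain ⟨z, hz⟩ : ∃ z, z ∈ S 0 := by
    obtain ⟨k, hk⟩ := exists_iterate_mem_periodicPts f v
    exact ⟨_, (hS0 _).2 hk⟩
  -- If some `S c` is everything, it is dropped and the other two cover each point once. One of them
  -- is `S 0`, which is neither full nor empty, so both are proper.
  by_cases hfull : ∃ c, S c = Finset.univ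
  · obtain ⟨c, hc⟩ := hfull
    have hcount' (x : X) : (Finset.univ.filter fun i => x ∈ S (c.succAbove i)).card = 1 := by
      have h := hcount x
      rw [Finset.card_filter, Fin.sum_univ_succAbove _ c, if_pos (hc ▸ Finset.mem_univ x),
        ← Finset.card_filter] at h
      omega
    refine ⟨1, 2, fun i => S (c.succAbove i), fun i => ρ (c.succAbove i), one_pos, ?_,
      fun i => hinv _, fun i => harc _, hcount'⟩
    intro i hi
    have h0 : (0 : Fin 3) ≠ c := fun h => hS0ne (h ▸ hc)
    obtain ⟨j, hj⟩ := Fin.exists_succAbove_eq h0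
    have hij : i ≠ j := fun h => hS0ne (hj ▸ h ▸ hi)
    have h1 := hcount' z
    have h2 : ({i, j} : Finset (Fin 2)) ⊆ Finset.univ.filter fun i => z ∈ S (c.succAbove i) := by
      intro k hk
      rw [Finset.mem_insert, Finset.mem_singleton] at hk
      rcases hk with rfl | rfl
      · simp [hi]
      · simp [hj, hz]
    have h3 := Finset.card_le_card h2
    rw [Finset.card_pair hij] at h3
    omega
  · push Not at hfull
    exact ⟨2, 3, S, ρ, two_pos, hfull, hinv, harc, hcount⟩

variable [DecidableEq Y]

/-- `a` is the only perfect matching from `W` to its image along `G`. -/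
def IsRigid (G : X → Y → Prop) (W : Finset X) (a : X → Y) : Prop :=
  ∀ τ : Equiv.Perm X, (∀ x ∈ W, τ x ∈ W) → (∀ x ∉ W, τ x = x) → (∀ x ∈ W, G (τ x) (a x)) → τ = 1

/-- `a` is a perfect matching from `W` to `U` along `G`. -/
def IsPerfectMatching (G : X → Y → Prop) (W : Finset X) (U : Finset Y) (a : X → Y) : Prop :=
  Set.BijOn a W U ∧ ∀ x ∈ W, G x (a x)

/-- A nontrivial `τ` gives a second `G`-matching `a ∘ τ⁻¹`. Comparing both with `b` yields two
different permutations of `W`, every arc `x → y` of which satisfies `G x (b y)`. A subset permuted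
along such arcs therefore carries a `G`-matching onto its image under `b`, where `b` is still an
`H`-matching. -/
theorem exists_smaller_matchings {G H : X → Y → Prop} {W : Finset X} {U : Finset Y} {a b : X → Y}
    (ha : IsPerfectMatching G W U a) (hb : IsPerfectMatching H W U b) (hr : ¬ IsRigid G W a) :
    ∃ (n m : ℕ) (W' : Fin m → Finset X) (U' : Fin m → Finset Y) (a' : Fin m → X → Y), 0 < n ∧
      (∀ i, W' i ⊂ W ∧ U' i ⊆ U ∧ IsPerfectMatching G (W' i) (U' i) (a' i) ∧
        IsPerfectMatching H (W' i) (U' i) b) ∧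
      (∀ x ∈ W, (Finset.univ.filter fun i => x ∈ W' i).card = n) ∧
      ∀ y ∈ U, (Finset.univ.filter fun i => y ∈ U' i).card = n := by
  simp only [IsRigid, not_forall] at hr
  obtain ⟨τ, hτW, hτ', hτG, hτ1⟩ := hr
  have hτiff (x : X) : τ x ∈ W ↔ x ∈ W := by
    refine ⟨fun h => ?_, hτW x⟩
    by_contra hx
    exact hx (hτ' x hx ▸ h)
  set τW : Equiv.Perm {x // x ∈ W} := τ.subtypePerm hτiff with hτWdef
  set σ : Equiv.Perm {x // x ∈ W} := 
    (Set.BijOn.equiv a ha.1).trans (Set.BijOn.equiv b hb.1).symm with hσ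
  have hbσ (x : {x // x ∈ W}) : b (σ x) = a x :=
    congrArg Subtype.val (Equiv.apply_symm_apply (Set.BijOn.equiv b hb.1) (Set.BijOn.equiv a ha.1 x))
  have hne : σ ≠ σ * τW⁻¹ := by
    intro h
    have h1 : τW = 1 := by
      have := congrArg (σ⁻¹ * ·) h
      simpa [eq_comm] using this
    refine hτ1 (Equiv.ext fun x => ?_)
    by_cases hx : x ∈ W
    · exact congrArg Subtype.val (Equiv.congr_fun h1 ⟨x, hx⟩)
    · exact hτ' x hx
  obtain ⟨n, m, S, ρ, hn, hS1, hS2, hS3, hS4⟩ := exists_splitsInto hne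
  set W' : Fin m → Finset X := fun i => (S i).map (Function.Embedding.subtype _) with hW'
  have hmem (i : Fin m) (x : {x // x ∈ W}) : (x : X) ∈ W' i ↔ x ∈ S i := by simp [hW']
  have hW'W (i : Fin m) : W' i ⊆ W := by
    intro x hx
    obtain ⟨z, -, rfl⟩ := Finset.mem_map.1 hx
    exact z.2
  refine ⟨n, m, W', fun i => (W' i).image b,
    fun i x => if h : x ∈ W then b (ρ i ⟨x, h⟩) else a x, hn, fun i => ⟨?_, ?_, ⟨?_, ?_⟩, ?_, ?_⟩,
    ?_, ?_⟩
  · refine (Finset.ssubset_iff_subset_ne).2 ⟨hW'W i, fun h => hS1 i ?_⟩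
    exact Finset.eq_univ_iff_forall.2 fun x => (hmem i x).1 (h.ge x.2)
  · rw [Finset.image_subset_iff]
    exact fun x hx => hb.1.mapsTo (hW'W i hx)
  · have hinj : Set.InjOn (fun x => if h : x ∈ W then b (ρ i ⟨x, h⟩) else a x)
        (W' i : Set X) := by
      intro x hx y hy hxy
      have hx' := hW'W i hx
      have hy' := hW'W i hy
      simp only [hx', hy', dif_pos] at hxy
      have := (ρ i).injective (Subtype.ext (hb.1.injOn (ρ i ⟨x, hx'⟩).2 (ρ i ⟨y, hy'⟩).2 hxy))
      exact congrArg Subtype.val this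
    have hmaps : Set.MapsTo (fun x => if h : x ∈ W then b (ρ i ⟨x, h⟩) else a x) (W' i : Set X)
        ((W' i).image b : Finset Y) := by
      intro x hx
      have hx' := hW'W i hx
      simp only [hx', dif_pos]
      exact Finset.mem_image_of_mem _ ((hmem i _).2 (hS2 i _ ((hmem i ⟨x, hx'⟩).1 hx)))
    refine ⟨hmaps, hinj, Finset.surjOn_of_injOn_of_card_le _ hmaps hinj ?_⟩
    exact Finset.card_image_le
  · intro x hx
    have hx' := hW'W i hx
    simp only [hx', dif_pos]
    rcases hS3 i ⟨x, hx'⟩ ((hmem i ⟨x, hx'⟩).1 hx) with h | h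
    · rw [h, hbσ]
      exact ha.2 x hx'
    · rw [h, Equiv.Perm.mul_apply, hbσ]
      have h1 := hτG _ (τW⁻¹ ⟨x, hx'⟩).2
      have h2 : τ (τW⁻¹ ⟨x, hx'⟩ : {x // x ∈ W}) = x :=
        congrArg Subtype.val (Equiv.apply_symm_apply τW ⟨x, hx'⟩)
      rwa [h2] at h1
  · rw [Finset.coe_image]
    exact (hb.1.injOn.mono (hW'W i)).bijOn_image
  · exact fun x hx => hb.2 x (hW'W i hx)
  · intro x hx
    rw [← hS4 ⟨x, hx⟩]
    simp only [← hmem]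
  · intro y hy
    obtain ⟨x, hx, rfl⟩ := hb.1.surjOn hy
    rw [← hS4 ⟨x, hx⟩]
    congr 1
    ext i
    simp only [Finset.mem_filter, Finset.mem_univ, true_and, ← hmem, Finset.mem_image]
    refine ⟨?_, fun h => ⟨x, h, rfl⟩⟩
    rintro ⟨z, hz, hzx⟩
    exact hb.1.injOn (hW'W i hz) hx hzx ▸ hz

/-- Nested covers compose once their multiplicities agree: repeating the `i`-th subfamily `c i`
times makes each of them a `K`-fold cover. -/
theorem card_filter_sigma_eq {Z : Type*} [DecidableEq Z] {m n K : ℕ} {c k : Fin m → ℕ}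
    (hc : ∀ i, c i * k i = K) {ι : Fin m → Type} [∀ i, Fintype (ι i)] {V : Finset Z}
    (V₁ : Fin m → Finset Z) (V₂ : ∀ i, ι i → Finset Z) (hsub : ∀ i j, V₂ i j ⊆ V₁ i)
    (hV : ∀ x ∈ V, (Finset.univ.filter fun i => x ∈ V₁ i).card = n)
    (hV2 : ∀ i, ∀ x ∈ V₁ i, (Finset.univ.filter fun j => x ∈ V₂ i j).card = k i) :
    ∀ x ∈ V, (Finset.univ.filter fun z : Σ i, Fin (c i) × ι i => x ∈ V₂ z.1 z.2.2).card
      = K * n := by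
  intro x hx
  rw [Finset.card_filter, Fintype.sum_sigma, ← hV x hx, Finset.card_filter, Finset.mul_sum]
  refine Finset.sum_congr rfl fun i _ => ?_
  rw [Fintype.sum_prod_type]
  simp only [← Finset.card_filter, Finset.sum_const, Finset.card_univ, Fintype.card_fin,
    smul_eq_mul]
  split_ifs with hxi
  · rw [hV2 i x hxi, hc, mul_one]
  · rw [Finset.card_eq_zero.2, mul_zero, mul_zero]
    exact Finset.filter_eq_empty_iff.2 fun j _ h => hxi (hsub i j h)

/-- Two perfect matchings between the same sets decompose fractionally into pairs of rigid ones. -/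
theorem exists_rigid_decomposition {G H : X → Y → Prop} {W : Finset X} {U : Finset Y}
    {a b : X → Y} (ha : IsPerfectMatching G W U a) (hb : IsPerfectMatching H W U b) :
    ∃ (n : ℕ) (ι : Type) (_ : Fintype ι) (W' : ι → Finset X) (U' : ι → Finset Y)
      (a' b' : ι → X → Y), 0 < n ∧
      (∀ i, W' i ⊆ W ∧ U' i ⊆ U ∧
        IsPerfectMatching G (W' i) (U' i) (a' i) ∧ IsRigid G (W' i) (a' i) ∧
        IsPerfectMatching H (W' i) (U' i) (b' i) ∧ IsRigid H (W' i) (b' i)) ∧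
      (∀ x ∈ W, (Finset.univ.filter fun i => x ∈ W' i).card = n) ∧
      ∀ y ∈ U, (Finset.univ.filter fun i => y ∈ U' i).card = n := by
  induction hc : W.card using Nat.strong_induction_on generalizing W U a b with
  | _ c ih =>
  by_cases hr : IsRigid G W a ∧ IsRigid H W b
  · refine ⟨1, Unit, inferInstance, fun _ => W, fun _ => U, fun _ => a, fun _ => b, one_pos,
      fun _ => ⟨subset_rfl, subset_rfl, ha, hr.1, hb, hr.2⟩, fun x hx => ?_, fun y hy => ?_⟩
    · simp [hx]
    · simp [hy]
  obtain ⟨n, m, W₁, U₁, a₁, b₁, hn, h1, hW, hU⟩ :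
      ∃ (n m : ℕ) (W' : Fin m → Finset X) (U' : Fin m → Finset Y) (a' b' : Fin m → X → Y), 0 < n ∧
        (∀ i, W' i ⊂ W ∧ U' i ⊆ U ∧ IsPerfectMatching G (W' i) (U' i) (a' i) ∧
          IsPerfectMatching H (W' i) (U' i) (b' i)) ∧
        (∀ x ∈ W, (Finset.univ.filter fun i => x ∈ W' i).card = n) ∧
        ∀ y ∈ U, (Finset.univ.filter fun i => y ∈ U' i).card = n := by
    rw [not_and_or] at hr
    rcases hr with hr | hr
    · obtain ⟨n, m, W', U', a', hn, h, hW, hU⟩ := exists_smaller_matchings ha hb hr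
      exact ⟨n, m, W', U', a', fun _ => b, hn, h, hW, hU⟩
    · obtain ⟨n, m, W', U', a', hn, h, hW, hU⟩ := exists_smaller_matchings hb ha hr
      exact ⟨n, m, W', U', fun _ => a, a', hn,
        fun i => ⟨(h i).1, (h i).2.1, (h i).2.2.2, (h i).2.2.1⟩, hW, hU⟩
  choose k ι hι W₂ U₂ a₂ b₂ hk h2 hW2 hU2 using fun i =>
    ih _ (hc ▸ Finset.card_lt_card (h1 i).1) (h1 i).2.2.1 (h1 i).2.2.2 rfl
  set K := ∏ i, k i with hK
  have hKi (i : Fin m) : K / k i * k i = K :=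
    Nat.div_mul_cancel (Finset.dvd_prod_of_mem k (Finset.mem_univ i))
  refine ⟨K * n, Σ i, Fin (K / k i) × ι i, inferInstance, fun z => W₂ z.1 z.2.2,
    fun z => U₂ z.1 z.2.2, fun z => a₂ z.1 z.2.2, fun z => b₂ z.1 z.2.2,
    Nat.mul_pos (Finset.prod_pos fun i _ => hk i) hn, ?_, ?_, ?_⟩
  · intro z
    obtain ⟨h3, h4, h5⟩ := h2 z.1 z.2.2
    exact ⟨h3.trans (h1 z.1).1.subset, h4.trans (h1 z.1).2.1, h5⟩
  · exact card_filter_sigma_eq hKi W₁ W₂ (fun i j => (h2 i j).1) hW hW2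
  · exact card_filter_sigma_eq hKi U₁ U₂ (fun i j => (h2 i j).2.1) hU hU2

end Rigid

/-! ### Two facts on submodular functions -/

section Rado

/-- Rado's theorem for submodular functions: a family satisfying Hall's condition with respect to
`g` has a system of representatives of full `g`-value. -/
theorem exists_representatives_of_submodular {J E : Type*} [Fintype J] [DecidableEq J]
    [DecidableEq E] {g : Finset E → ℕ} (hg0 : g ∅ = 0) (hmono : Monotone g)
    (hsub : ∀ S T, g (S ∩ T) + g (S ∪ T) ≤ g S + g T) (S : J → Finset E)
    (hS : ∀ K : Finset J, K.card ≤ g (K.biUnion S)) :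
    ∃ e : J → E, (∀ j, e j ∈ S j) ∧ Fintype.card J ≤ g (Finset.univ.image e) := by
  induction hc : ∑ j, (S j).card using Nat.strong_induction_on generalizing S with
  | _ c ih =>
  by_cases hone : ∀ j, (S j).card = 1
  · choose e he using fun j => Finset.card_eq_one.1 (hone j)
    refine ⟨e, fun j => by simp [he], ?_⟩
    have h := hS Finset.univ
    rw [Finset.card_univ] at h
    convert h using 2
    ext x
    simp [he, eq_comm]
  push Not at hone
  obtain ⟨j, hj⟩ := hone
  have hpos : (S j).card ≠ 0 := by
    intro h
    have h1 := hS {j}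
    rw [Finset.singleton_biUnion, Finset.card_eq_zero.1 h, hg0] at h1
    simp at h1
  -- A set with two elements `x` and `y` can be shrunk. If deleting `x` violated Hall's condition at
  -- `K` and deleting `y` violated it at `L`, then Hall's condition for `K ∪ L` and `(K ∩ L).erase
  -- j` would contradict submodularity.
  obtain ⟨x, hx, y, hy, hxy⟩ := Finset.one_lt_card.1 (by omega : 1 < (S j).card)
  by_cases hred : ∃ z ∈ S j, ∀ K : Finset J,
      K.card ≤ g (K.biUnion (Function.update S j ((S j).erase z)))
  · obtain ⟨z, hz, hK⟩ := hred
    obtain ⟨e, he, hcard⟩ := ih _ (by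
      rw [← hc]
      refine Finset.sum_lt_sum (fun i _ => ?_) ⟨j, Finset.mem_univ _, ?_⟩
      · by_cases hi : i = j
        · subst hi; simpa using Finset.card_le_card (Finset.erase_subset z (S i))
        · simp [hi]
      · simpa using Finset.card_erase_lt_of_mem hz) _ hK rfl
    refine ⟨e, fun i => ?_, hcard⟩
    have := he i
    by_cases hi : i = j
    · subst hi
      rw [Function.update_self] at this
      exact Finset.mem_of_mem_erase this
    · rwa [Function.update_of_ne hi] at this
  · exfalso
    push Not at hred
    have hmem : ∀ z (K : Finset J),
        g (K.biUnion (Function.update S j ((S j).erase z))) < K.card → j ∈ K := by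
      intro z K hK
      by_contra hjK
      refine absurd (hS K) (not_le.2 (lt_of_eq_of_lt (congrArg g ?_) hK))
      exact Finset.biUnion_congr rfl fun i hi =>
        (Function.update_of_ne (fun h => hjK (by rw [← h]; exact hi)) _ _).symm
    have herase : ∀ z (K : Finset J), (K.erase j).biUnion S ⊆
        K.biUnion (Function.update S j ((S j).erase z)) := by
      intro z K w hw
      obtain ⟨i, hi, hwi⟩ := Finset.mem_biUnion.1 hw
      obtain ⟨hij, hiK⟩ := Finset.mem_erase.1 hi
      exact Finset.mem_biUnion.2 ⟨i, hiK, by rwa [Function.update_of_ne hij]⟩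
    have hself : ∀ z (K : Finset J), j ∈ K →
        (S j).erase z ⊆ K.biUnion (Function.update S j ((S j).erase z)) := by
      intro z K hjK w hw
      exact Finset.mem_biUnion.2 ⟨j, hjK, by rwa [Function.update_self]⟩
    obtain ⟨K, hK⟩ := hred x hx
    obtain ⟨L, hL⟩ := hred y hy
    have hjK := hmem x K hK
    have hjL := hmem y L hL
    set P := K.biUnion (Function.update S j ((S j).erase x))
    set Q := L.biUnion (Function.update S j ((S j).erase y))
    have hun : (K ∪ L).biUnion S ⊆ P ∪ Q := by
      intro w hw
      obtain ⟨i, hi, hwi⟩ := Finset.mem_biUnion.1 hw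
      by_cases hij : i = j
      · subst hij
        by_cases hwx : w = x
        · exact Finset.mem_union_right _ (hself y L hjL
            (Finset.mem_erase.2 ⟨fun h => hxy (hwx ▸ h), hwi⟩))
        · exact Finset.mem_union_left _ (hself x K hjK (Finset.mem_erase.2 ⟨hwx, hwi⟩))
      · rcases Finset.mem_union.1 hi with hi | hi
        · exact Finset.mem_union_left _ (herase x K
            (Finset.mem_biUnion.2 ⟨i, Finset.mem_erase.2 ⟨hij, hi⟩, hwi⟩))
        · exact Finset.mem_union_right _ (herase y L
            (Finset.mem_biUnion.2 ⟨i, Finset.mem_erase.2 ⟨hij, hi⟩, hwi⟩))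
    have hin : ((K ∩ L).erase j).biUnion S ⊆ P ∩ Q := by
      refine Finset.subset_inter ?_ ?_
      · exact (Finset.biUnion_subset_biUnion_of_subset_left _
          (Finset.erase_subset_erase j Finset.inter_subset_left)).trans (herase x K)
      · exact (Finset.biUnion_subset_biUnion_of_subset_left _
          (Finset.erase_subset_erase j Finset.inter_subset_right)).trans (herase y L)
    have h1 := (hS _).trans (hmono hun)
    have h2 := (hS _).trans (hmono hin)
    have h3 := hsub P Q
    have h4 := Finset.card_union_add_card_inter K L
    have h5 := Finset.card_erase_of_mem (Finset.mem_inter.2 ⟨hjK, hjL⟩)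
    have h6 : 0 < (K ∩ L).card := Finset.card_pos.2 ⟨j, Finset.mem_inter.2 ⟨hjK, hjL⟩⟩
    omega

/-- A submodular function is fractionally subadditive over exact `k`-fold covers. -/
theorem submodular_cover_le {N ι : Type*} [DecidableEq N] [Fintype ι] {h : Finset N → ℕ}
    (hsub : ∀ S T, h (S ∩ T) + h (S ∪ T) ≤ h S + h T) (Y : ι → Finset N) {k : ℕ} (V : Finset N)
    (hV : ∀ v ∈ V, (Finset.univ.filter fun i => v ∈ Y i).card = k) :
    k * h V + Fintype.card ι * h ∅ ≤ ∑ i, h (Y i ∩ V) + k * h ∅ := by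
  induction V using Finset.induction_on with
  | empty => simp [add_comm]
  | insert v V hv ih =>
    have h1 := ih fun w hw => hV w (Finset.mem_insert_of_mem hw)
    -- Diminishing returns: adding `v` raises `h` on `Y i ∩ V` by at least as much as on `V` for the
    -- `k` sets containing `v`, and changes nothing for the others.
    have h2 : ∑ i, (h (Y i ∩ V) + if v ∈ Y i then h (insert v V) else 0)
        ≤ ∑ i, (h (Y i ∩ insert v V) + if v ∈ Y i then h V else 0) := by
      refine Finset.sum_le_sum fun i _ => ?_
      split_ifs with hi
      · have h3 := hsub (Y i ∩ insert v V) V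
        have h4 : Y i ∩ insert v V ∩ V = Y i ∩ V := by
          rw [Finset.inter_assoc, Finset.inter_eq_right.2 (Finset.subset_insert v V)]
        have h5 : Y i ∩ insert v V ∪ V = insert v V := by
          ext w
          simp only [Finset.mem_union, Finset.mem_inter, Finset.mem_insert]
          constructor
          · tauto
          · rintro (rfl | hw)
            · exact Or.inl ⟨hi, Or.inl rfl⟩
            · exact Or.inr hw
        rwa [h4, h5] at h3
      · rw [Finset.inter_insert_of_notMem hi]
    rw [Finset.sum_add_distrib, Finset.sum_add_distrib, ← Finset.sum_filter, ← Finset.sum_filter,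
      Finset.sum_const, Finset.sum_const, hV v (Finset.mem_insert_self v V), smul_eq_mul,
      smul_eq_mul] at h2
    omega

end Rado

/-! ### Matroid rank and the Rota-type exchange -/

section Rota

variable {N : Type*} [DecidableEq N]

/-- The rank of a finite set in a matroid as a natural number. -/
noncomputable def finsetRank (M : Matroid N) (S : Finset N) : ℕ := (M.eRk (S : Set N)).toNat

theorem coe_finsetRank (M : Matroid N) (S : Finset N) :
    (finsetRank M S : ℕ∞) = M.eRk (S : Set N) :=
  ENat.natCast_toNat (ne_top_of_le_ne_top (Set.encard_ne_top_iff.2 S.finite_toSet) (M.eRk_le_encard _))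

theorem finsetRank_mono (M : Matroid N) : Monotone (finsetRank M) := by
  intro S T h
  have := M.eRk_mono (Finset.coe_subset.2 h)
  rw [← coe_finsetRank, ← coe_finsetRank] at this
  exact_mod_cast this

theorem finsetRank_submodular (M : Matroid N) (S T : Finset N) :
    finsetRank M (S ∩ T) + finsetRank M (S ∪ T) ≤ finsetRank M S + finsetRank M T := by
  have := M.eRk_inter_add_eRk_union_le (S : Set N) (T : Set N)
  rw [← Finset.coe_inter, ← Finset.coe_union] at this
  simp only [← coe_finsetRank] at this
  exact_mod_cast this

theorem finsetRank_le_card (M : Matroid N) (S : Finset N) : finsetRank M S ≤ S.card := by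
  have := M.eRk_le_encard (S : Set N)
  rw [← coe_finsetRank, Set.encard_coe_eq_coe_finsetCard] at this
  exact_mod_cast this

theorem indep_iff_finsetRank {M : Matroid N} {S : Finset N} :
    M.Indep (S : Set N) ↔ finsetRank M S = S.card := by
  rw [Matroid.indep_iff_eRk_eq_encard_of_finite S.finite_toSet, ← coe_finsetRank,
    Set.encard_coe_eq_coe_finsetCard]
  exact_mod_cast Iff.rfl

/-- While the new set is smaller than `A`, it can be augmented from `A`, and each augmenting element
is one that had been removed. -/
theorem exists_small_removal {M : Matroid N} {A Y Z : Finset N} (hA : M.Indep (A : Set N))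
    (hZA : Z ⊆ A) (hYZ : M.Indep (((A \ Z) ∪ Y : Finset N) : Set N)) :
    ∃ Z' ⊆ Z, Z'.card ≤ Y.card ∧ M.Indep (((A \ Z') ∪ Y : Finset N) : Set N) := by
  induction hc : Z.card using Nat.strong_induction_on generalizing Z with
  | _ c ih =>
  by_cases hle : Z.card ≤ Y.card
  · exact ⟨Z, subset_rfl, hle, hYZ⟩
  have hlt : ((A \ Z) ∪ Y).card < A.card := by
    have h1 := Finset.card_union_le (A \ Z) Y
    have h2 := Finset.card_sdiff_add_card_eq_card hZA
    omega
  obtain ⟨e, he, hins⟩ := hYZ.exists_insert_of_encard_lt hA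
    (by rw [Set.encard_coe_eq_coe_finsetCard, Set.encard_coe_eq_coe_finsetCard]
        exact_mod_cast hlt)
  have heA : e ∈ A := he.1
  have heZ : e ∈ Z := by
    by_contra h
    exact he.2 (Finset.mem_coe.2 (Finset.mem_union_left _ (Finset.mem_sdiff.2 ⟨heA, h⟩)))
  obtain ⟨Z', hZ', h⟩ := ih _ (hc ▸ Finset.card_erase_lt_of_mem heZ)
    ((Finset.erase_subset e Z).trans hZA)
    (by
      refine hins.subset fun x hx => ?_
      simp only [Finset.coe_union, Finset.coe_sdiff, Finset.coe_erase, Set.mem_union,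
        Set.mem_sdiff, Finset.mem_coe, Set.mem_singleton_iff, Set.mem_insert_iff] at hx ⊢
      tauto) rfl
  exact ⟨Z', hZ'.trans (Finset.erase_subset e Z), h⟩

/-- The generalized Rota exchange property. -/
theorem exists_rota_exchange {ι : Type*} [Fintype ι] [DecidableEq ι] {M : Matroid N}
    {A B : Finset N} (hA : M.Indep (A : Set N)) (hB : M.Indep (B : Set N)) {k : ℕ}
    (Y : ι → Finset N) (hYB : ∀ i, Y i ⊆ B \ A)
    (hY : ∀ v ∈ B \ A, (Finset.univ.filter fun i => v ∈ Y i).card = k) :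
    ∃ Z : ι → Finset N,
      (∀ i, Z i ⊆ A \ B ∧ (Z i).card ≤ (Y i).card ∧
        M.Indep (((A \ Z i) ∪ Y i : Finset N) : Set N)) ∧
      ∀ u, (Finset.univ.filter fun i => u ∈ Z i).card ≤ k := by
  set m := Fintype.card ι with hm
  set D : ι → Finset N := fun i => Y i ∪ (A ∩ B) with hD
  have hDB (i) : D i ⊆ B := by
    refine Finset.union_subset ((hYB i).trans Finset.sdiff_subset) Finset.inter_subset_right
  have hDcard (i) : (D i).card = (Y i).card + (A ∩ B).card := by
    refine Finset.card_union_of_disjoint (Finset.disjoint_left.2 fun x hx hx' => ?_)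
    exact (Finset.mem_sdiff.1 (hYB i hx)).2 (Finset.mem_inter.1 hx').1
  have hDrank (i) : finsetRank M (D i) = (D i).card :=
    indep_iff_finsetRank.1 (hB.subset (Finset.coe_subset.2 (hDB i)))
  have hDle (i) (T : Finset N) : (D i).card ≤ finsetRank M (D i ∪ T) :=
    hDrank i ▸ finsetRank_mono M Finset.subset_union_left
  have hsumY : ∑ i, (Y i).card = k * (B \ A).card := by
    have h1 (i) : (Y i).card = ∑ v ∈ B \ A, if v ∈ Y i then 1 else 0 := by
      rw [← Finset.card_filter, Finset.filter_mem_eq_inter, Finset.inter_eq_right.2 (hYB i)]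
    simp only [h1]
    rw [Finset.sum_comm]
    simp only [← Finset.card_filter]
    rw [Finset.sum_congr rfl hY, Finset.sum_const, smul_eq_mul, mul_comm]
  -- Hall's condition for keeping each element of `A \ B` at `m - k` indices. It follows from
  -- fractional subadditivity of the rank after joining `(A ∩ B) ∪ S`: the value at `∅` is `|A ∩ B|
  -- + |S|`, and the value at `B \ A` is at least `|B|`.
  have hrado (S : Finset N) (hS : S ⊆ A \ B) :
      S.card * (m - k) ≤ ∑ i, (finsetRank M (D i ∪ S) - (D i).card) := by
    rw [Finset.sum_tsub_distrib _ fun i _ => hDle i S]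
    rcases le_total m k with hmk | hmk
    · simp [Nat.sub_eq_zero_of_le hmk]
    have h1 := submodular_cover_le (h := fun T => finsetRank M (T ∪ ((A ∩ B) ∪ S)))
      (fun P Q => by
        rw [Finset.inter_union_distrib_right, Finset.union_union_distrib_right]
        exact finsetRank_submodular M _ _) Y (B \ A) hY
    have h2 : finsetRank M (∅ ∪ ((A ∩ B) ∪ S)) = (A ∩ B).card + S.card := by
      rw [Finset.empty_union, indep_iff_finsetRank.1, Finset.card_union_of_disjoint]
      · refine Finset.disjoint_left.2 fun x hx hx' => ?_
        exact (Finset.mem_sdiff.1 (hS hx')).2 (Finset.mem_inter.1 hx).2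
      · exact hA.subset (Finset.coe_subset.2
          (Finset.union_subset Finset.inter_subset_left (hS.trans Finset.sdiff_subset)))
    have h3 : (B \ A).card + (A ∩ B).card ≤ finsetRank M (B \ A ∪ ((A ∩ B) ∪ S)) := by
      have h4 : (B \ A).card + (A ∩ B).card = B.card := by
        rw [Finset.inter_comm]; exact Finset.card_sdiff_add_card_inter B A
      rw [h4, ← indep_iff_finsetRank.1 hB]
      refine finsetRank_mono M fun x hx => ?_
      by_cases hxA : x ∈ A
      · simp [hx, hxA]
      · simp [hx, hxA]
    have h5 (i) : finsetRank M (Y i ∩ (B \ A) ∪ ((A ∩ B) ∪ S)) = finsetRank M (D i ∪ S) := by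
      rw [Finset.inter_eq_left.2 (hYB i), ← Finset.union_assoc]
    simp only [h2, h5] at h1
    have h6 : ∑ i, (D i).card = k * (B \ A).card + m * (A ∩ B).card := by
      simp only [hDcard, Finset.sum_add_distrib, hsumY, Finset.sum_const, Finset.card_univ,
        smul_eq_mul, hm]
    rw [h6]
    obtain ⟨d, hd⟩ := Nat.exists_eq_add_of_le hmk
    rw [hd, Nat.add_sub_cancel_left]
    rw [← hm, hd] at h1
    have h7 := Nat.mul_le_mul_left k h3
    refine Nat.le_sub_of_add_le ?_
    nlinarith
  -- `g` adds up the ranks in the contractions of `M` by the independent sets `D i`. The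
  -- representative `(i, u)` means that `u` is kept at index `i`.
  obtain ⟨e, he, hcard⟩ := exists_representatives_of_submodular
    (J := {u // u ∈ A \ B} × Fin (m - k)) (E := ι × N)
    (g := fun T => ∑ i, (finsetRank M (D i ∪ (T.filter fun z => z.1 = i).image Prod.snd)
      - (D i).card))
    (by simp [hDrank])
    (by
      intro T T' hT
      refine Finset.sum_le_sum fun i _ => Nat.sub_le_sub_right (finsetRank_mono M ?_) _
      exact Finset.union_subset_union_right
        (Finset.image_subset_image (Finset.filter_subset_filter _ hT)))
    (by
      intro T T'
      rw [← Finset.sum_add_distrib, ← Finset.sum_add_distrib]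
      refine Finset.sum_le_sum fun i _ => ?_
      have h1 := finsetRank_submodular M (D i ∪ (T.filter fun z => z.1 = i).image Prod.snd)
        (D i ∪ (T'.filter fun z => z.1 = i).image Prod.snd)
      rw [← Finset.union_inter_distrib_left, ← Finset.union_union_distrib_left,
        ← Finset.image_union, ← Finset.filter_union] at h1
      have h2 : finsetRank M (D i ∪ ((T ∩ T').filter fun z => z.1 = i).image Prod.snd) ≤
          finsetRank M (D i ∪ ((T.filter fun z => z.1 = i).image Prod.snd ∩
            (T'.filter fun z => z.1 = i).image Prod.snd)) := by
        refine finsetRank_mono M (Finset.union_subset_union_right ?_)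
        rw [Finset.filter_inter_distrib]
        exact Finset.image_inter_subset _ _ _
      have h3 := hDle i (((T ∩ T').filter fun z => z.1 = i).image Prod.snd)
      have h4 := hDle i (((T ∪ T').filter fun z => z.1 = i).image Prod.snd)
      omega)
    (fun j => Finset.univ.image fun i => (i, (j.1 : N)))
    (by
      intro K
      set S : Finset N := K.image fun j => (j.1 : N) with hS
      have h1 : K.card ≤ S.card * (m - k) := by
        have : K.card ≤ (S ×ˢ (Finset.univ : Finset (Fin (m - k)))).card := by
          refine Finset.card_le_card_of_injOn (fun j => ((j.1 : N), j.2)) ?_ ?_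
          · intro j hj
            simp only [Finset.coe_product, Set.mem_prod, Finset.mem_coe, Finset.mem_univ, and_true]
            exact Finset.mem_image_of_mem _ hj
          · intro j _ j' _ h
            rw [Prod.mk.injEq] at h
            exact Prod.ext (Subtype.ext h.1) h.2
        simpa using this
      refine h1.trans ((hrado S ?_).trans_eq ?_)
      · rw [hS, Finset.image_subset_iff]
        exact fun j _ => j.1.2
      · refine Finset.sum_congr rfl fun i _ => ?_
        congr 3
        ext u
        simp only [hS, Finset.mem_image, Finset.mem_filter, Finset.mem_biUnion, Finset.mem_univ,
          true_and, Prod.exists]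
        constructor
        · rintro ⟨j, c, hj, rfl⟩
          exact ⟨i, _, ⟨⟨j, c, hj, i, rfl⟩, rfl⟩, rfl⟩
        · rintro ⟨i', u', ⟨⟨j, c, hj, i'', h⟩, rfl⟩, rfl⟩
          rw [Prod.mk.injEq] at h
          exact ⟨j, c, hj, h.2⟩)
  have he2 (j) : (e j).2 = j.1 := by
    obtain ⟨i, -, h⟩ := Finset.mem_image.1 (he j)
    rw [← h]
  set T : ι → Finset N := fun i =>
    ((Finset.univ.image e).filter fun z => z.1 = i).image Prod.snd with hT
  have hmemT (i) (u) : u ∈ T i ↔ ∃ j, e j = (i, u) := by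
    simp only [hT, Finset.mem_image, Finset.mem_filter, Finset.mem_univ, true_and]
    constructor
    · rintro ⟨z, ⟨⟨j, rfl⟩, rfl⟩, rfl⟩
      exact ⟨j, rfl⟩
    · rintro ⟨j, hj⟩
      exact ⟨(i, u), ⟨⟨j, hj⟩, rfl⟩, rfl⟩
  have hle (i) : finsetRank M (D i ∪ T i) - (D i).card ≤ (T i).card := by
    have h1 := finsetRank_le_card M (D i ∪ T i)
    have h2 := Finset.card_union_le (D i) (T i)
    omega
  have hTsum : ∑ i, (T i).card ≤ (Finset.univ.image e).card := by
    rw [Finset.card_eq_sum_card_fiberwise (f := Prod.fst) (t := Finset.univ)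
      (fun _ _ => Finset.mem_coe.2 (Finset.mem_univ _))]
    exact Finset.sum_le_sum fun i _ => Finset.card_image_le
  have hecard : (Finset.univ.image e).card ≤ Fintype.card ({u // u ∈ A \ B} × Fin (m - k)) :=
    Finset.card_image_le
  -- The chain from the number of requests through `g`, the sum of the `|T i|` and the size of the
  -- image of `e` returns to the number of requests. Equality throughout makes `e` injective and
  -- each `D i ∪ T i` independent.
  have hinj : Function.Injective e := fun x y h =>
    Finset.card_image_iff.1 (le_antisymm hecard
      (hcard.trans ((Finset.sum_le_sum fun i _ => hle i).trans hTsum)))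
      (Finset.mem_coe.2 (Finset.mem_univ x)) (Finset.mem_coe.2 (Finset.mem_univ y)) h
  have heq (i) : finsetRank M (D i ∪ T i) - (D i).card = (T i).card := by
    refine (Finset.sum_eq_sum_iff_of_le fun i _ => hle i).1 (le_antisymm
      (Finset.sum_le_sum fun i _ => hle i) (hTsum.trans (hecard.trans hcard))) i
      (Finset.mem_univ i)
  have hindep (i) : M.Indep ((D i ∪ T i : Finset N) : Set N) := by
    rw [indep_iff_finsetRank]
    refine le_antisymm (finsetRank_le_card _ _) ?_
    have h1 := Finset.card_union_le (D i) (T i)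
    have h2 := heq i
    have h3 := hDle i (T i)
    omega
  have hex (i) := exists_small_removal (M := M) (Y := Y i) (Z := (A \ B) \ T i) hA
    (Finset.sdiff_subset.trans Finset.sdiff_subset) (by
      refine (hindep i).subset (Finset.coe_subset.2 fun x hx => ?_)
      simp only [hD, Finset.mem_union, Finset.mem_sdiff, Finset.mem_inter] at hx ⊢
      tauto)
  choose Z hZsub hZcard hZ using hex
  refine ⟨Z, fun i => ⟨(hZsub i).trans Finset.sdiff_subset, hZcard i, hZ i⟩, fun u => ?_⟩
  by_cases hu : u ∈ A \ B
  · have h1 : (Finset.univ.filter fun i => u ∈ Z i).card + (m - k) ≤ m := by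
      have h2 : m - k ≤ (Finset.univ.filter fun i => u ∈ T i).card := by
        rw [← Fintype.card_fin (m - k), ← Finset.card_univ]
        refine Finset.card_le_card_of_injOn (fun c => (e (⟨u, hu⟩, c)).1) ?_ ?_
        · intro c _
          simp only [Finset.coe_filter, Finset.mem_univ, true_and, Set.mem_ofPred_eq, hmemT]
          exact ⟨(⟨u, hu⟩, c), Prod.ext rfl (he2 _)⟩
        · intro c _ c' _ h
          have := hinj (Prod.ext h ((he2 (⟨u, hu⟩, c)).trans (he2 (⟨u, hu⟩, c')).symm))
          exact (Prod.mk.inj this).2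
      have h3 : Disjoint (Finset.univ.filter fun i => u ∈ Z i)
          (Finset.univ.filter fun i => u ∈ T i) := by
        refine Finset.disjoint_left.2 fun i hi hi' => ?_
        exact (Finset.mem_sdiff.1 (hZsub i (Finset.mem_filter.1 hi).2)).2 (Finset.mem_filter.1 hi').2
      have h4 := Finset.card_le_univ ((Finset.univ.filter fun i => u ∈ Z i) ∪
          (Finset.univ.filter fun i => u ∈ T i))
      rw [Finset.card_union_of_disjoint h3] at h4
      omega
    omega
  · rw [Finset.card_eq_zero.2]
    · exact Nat.zero_le _
    · refine Finset.filter_eq_empty_iff.2 fun i _ h => hu ?_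
      exact (Finset.mem_sdiff.1 (hZsub i h)).1

end Rota

/-! ### Simultaneous exchanges in matroids, and the exchange family of a matroid intersection -/

section MatroidExchange

variable {N : Type*} [Fintype N] [DecidableEq N]

/-- The exchange graph of the independent set `A`, padded with dummy elements: on the left `inl v`
is an element to be added and `inr _` a dummy; on the right `inr u` is an element to be removed and
`inl _` a dummy. -/
def paddedExchange (M : Matroid N) (A : Finset N) : N ⊕ N → N ⊕ N → Prop
  | Sum.inl v, Sum.inr u => M.Indep (insert v ((A : Set N) \ {u}))
  | Sum.inl v, Sum.inl _ => M.Indep (insert v (A : Set N))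
  | Sum.inr _, _ => True

/-- The Rota-type exchange with singletons and `k = 1` pairs each added element with at most one
removed element, injectively. The involution swapping the pairs and sending every unpaired element
to its own dummy is a perfect matching. -/
theorem exists_paddedExchange_matching {M : Matroid N} {A B : Finset N}
    (hA : M.Indep (A : Set N)) (hB : M.Indep (B : Set N)) :
    ∃ a : N ⊕ N → N ⊕ N, IsPerfectMatching (paddedExchange M A)
      ((B \ A).disjSum (A \ B)) ((B \ A).disjSum (A \ B)) a := by
  obtain ⟨Z, hZ, hZu⟩ := exists_rota_exchange (ι := {v // v ∈ B \ A}) (k := 1) hA hB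
    (fun v => {(v : N)}) (fun v => Finset.singleton_subset_iff.2 v.2)
    (by
      intro v hv
      rw [Finset.card_eq_one]
      refine ⟨⟨v, hv⟩, ?_⟩
      ext w
      simp [Subtype.ext_iff, eq_comm])
  set R : N → N → Prop := fun v u => ∃ h : v ∈ B \ A, u ∈ Z ⟨v, h⟩ with hR
  have hR1 {v u u' : N} (h : R v u) (h' : R v u') : u = u' := by
    obtain ⟨hv, hu⟩ := h
    obtain ⟨_, hu'⟩ := h'
    exact Finset.card_le_one.1 ((hZ ⟨v, hv⟩).2.1.trans (by simp)) u hu u' hu'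
  have hR2 {v v' u : N} (h : R v u) (h' : R v' u) : v = v' := by
    obtain ⟨hv, hu⟩ := h
    obtain ⟨hv', hu'⟩ := h'
    exact congrArg Subtype.val (Finset.card_le_one.1 (hZu u) ⟨v, hv⟩ (by simpa using hu)
      ⟨v', hv'⟩ (by simpa using hu'))
  have hRU {v u : N} (h : R v u) : u ∈ A \ B := (hZ _).1 h.choose_spec
  classical
  set a : N ⊕ N → N ⊕ N := fun x => match x with
    | Sum.inl v => if h : ∃ u, R v u then Sum.inr h.choose else Sum.inl v
    | Sum.inr u => if h : ∃ v, R v u then Sum.inl h.choose else Sum.inr u with ha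
  have ha1 {v u : N} (h : R v u) : a (Sum.inl v) = Sum.inr u := by
    have hex : ∃ u, R v u := ⟨u, h⟩
    simp only [ha, dif_pos hex]
    rw [hR1 hex.choose_spec h]
  have ha2 {v u : N} (h : R v u) : a (Sum.inr u) = Sum.inl v := by
    have hex : ∃ v, R v u := ⟨v, h⟩
    simp only [ha, dif_pos hex]
    rw [hR2 hex.choose_spec h]
  have ha3 {v : N} (h : ¬ ∃ u, R v u) : a (Sum.inl v) = Sum.inl v := by
    simp only [ha, dif_neg h]
  have ha4 {u : N} (h : ¬ ∃ v, R v u) : a (Sum.inr u) = Sum.inr u := by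
    simp only [ha, dif_neg h]
  have hinv (x : N ⊕ N) : a (a x) = x := by
    rcases x with v | u
    · by_cases h : ∃ u, R v u
      · obtain ⟨u, h⟩ := h
        rw [ha1 h, ha2 h]
      · rw [ha3 h, ha3 h]
    · by_cases h : ∃ v, R v u
      · obtain ⟨v, h⟩ := h
        rw [ha2 h, ha1 h]
      · rw [ha4 h, ha4 h]
  have hmaps : Set.MapsTo a ((B \ A).disjSum (A \ B) : Finset (N ⊕ N))
      ((B \ A).disjSum (A \ B) : Finset (N ⊕ N)) := by
    intro x hx
    rw [Finset.mem_coe] at hx ⊢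
    rcases x with v | u
    · by_cases h : ∃ u, R v u
      · obtain ⟨u, h⟩ := h
        rw [ha1 h, Finset.inr_mem_disjSum]
        exact hRU h
      · rwa [ha3 h]
    · by_cases h : ∃ v, R v u
      · obtain ⟨v, h⟩ := h
        rw [ha2 h, Finset.inl_mem_disjSum]
        exact h.choose
      · rwa [ha4 h]
  refine ⟨a, Set.InvOn.bijOn ⟨fun x _ => hinv x, fun x _ => hinv x⟩ hmaps hmaps, ?_⟩
  intro x hx
  rcases x with v | u
  · rw [Finset.inl_mem_disjSum] at hx
    have hind := (hZ ⟨v, hx⟩).2.2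
    by_cases h : ∃ u, R v u
    · obtain ⟨u, h⟩ := h
      rw [ha1 h]
      refine hind.subset fun x hxs => ?_
      simp only [Set.mem_insert_iff, Set.mem_sdiff, Finset.mem_coe, Set.mem_singleton_iff,
        Finset.mem_union, Finset.mem_sdiff, Finset.mem_singleton] at hxs ⊢
      rcases hxs with hxs | hxs
      · exact Or.inr hxs
      · exact Or.inl ⟨hxs.1, fun hxZ => hxs.2 (hR1 ⟨hx, hxZ⟩ h)⟩
    · rw [ha3 h]
      refine hind.subset fun x hxs => ?_
      simp only [Set.mem_insert_iff, Finset.mem_coe, Finset.mem_union, Finset.mem_sdiff,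
        Finset.mem_singleton] at hxs ⊢
      rcases hxs with hxs | hxs
      · exact Or.inr hxs
      · exact Or.inl ⟨hxs, fun hxZ => h ⟨x, hx, hxZ⟩⟩
  · trivial

/-- Exchanging along part of a rigid matching of the exchange graph preserves independence. -/
theorem indep_of_isRigid {M : Matroid N} (hE : M.E = Set.univ) {A : Finset N}
    (hA : M.Indep (A : Set N)) {W Q : Finset (N ⊕ N)} {a : N ⊕ N → N ⊕ N}
    (hr : IsRigid (paddedExchange M A) W a) (hWA : ∀ v, Sum.inl v ∈ W → v ∉ A)
    (ha : ∀ x ∈ W, paddedExchange M A x (a x)) (hQ : Q ⊆ W) {J : Finset N}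
    (hJ : ∀ x ∈ J, (x ∈ A ∧ Sum.inr x ∉ Q.image a) ∨ Sum.inl x ∈ Q) :
    M.Indep (J : Set N) := by
  by_contra hdep
  rw [Matroid.not_indep_iff (by rw [hE]; exact Set.subset_univ _)] at hdep
  obtain ⟨C, hCJ, hC⟩ := hdep.exists_isCircuit_subset
  -- Otherwise every element of `C \ {v}` lies in the closure of `A'`, which is `A` without the
  -- partner of `v`, or `A` itself if the partner is a dummy. As `C` is a circuit, `v` lies there
  -- too, contradicting the edge from `v` to its partner.
  have hkey : ∀ x : N ⊕ N, (∃ v ∈ C, x = Sum.inl v ∧ Sum.inl v ∈ Q) →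
      ∃ y, (∃ v ∈ C, y = Sum.inl v ∧ Sum.inl v ∈ Q) ∧ y ≠ x ∧ paddedExchange M A y (a x) := by
    rintro x ⟨v, hvC, rfl, hvQ⟩
    obtain ⟨A', hA'A, hA'v, hA'⟩ : ∃ A' : Set N, A' ⊆ A ∧
        (∀ w, paddedExchange M A (Sum.inl w) (a (Sum.inl v)) ↔ M.Indep (insert w A')) ∧
        ∀ x ∈ A, Sum.inr x ∉ Q.image a → x ∈ A' := by
      rcases hav : a (Sum.inl v) with d | u
      · exact ⟨A, subset_rfl, fun w => Iff.rfl, fun x hx _ => hx⟩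
      · refine ⟨(A : Set N) \ {u}, Set.sdiff_subset, fun w => Iff.rfl, fun x hx hxQ => ⟨hx, ?_⟩⟩
        rintro rfl
        exact hxQ (Finset.mem_image.2 ⟨_, hvQ, hav⟩)
    have hA'ind : M.Indep A' := hA.subset hA'A
    by_contra hno
    push Not at hno
    have hsub : C \ {v} ⊆ M.closure A' := by
      intro x hx
      rcases hJ x (hCJ hx.1) with h | h
      · exact M.mem_closure_of_mem' (hA' x h.1 h.2) (hE ▸ Set.mem_univ x)
      · rw [hA'ind.mem_closure_iff']
        refine ⟨hE ▸ Set.mem_univ x, fun hins => absurd ((hA'v x).2 hins) ?_⟩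
        exact hno _ ⟨x, hx.1, rfl, h⟩ fun h' => hx.2 (Sum.inl_injective h')
    have hv : v ∈ M.closure A' :=
      M.closure_subset_closure_of_subset_closure hsub (hC.mem_closure_sdiff_singleton_of_mem hvC)
    rw [hA'ind.mem_closure_iff'] at hv
    exact hWA v (hQ hvQ) (hA'A (hv.2 ((hA'v v).1 (ha _ (hQ hvQ)))))
  choose! g hg1 hg2 hg3 using hkey
  obtain ⟨v, hvC, hvQ⟩ : ∃ v ∈ C, Sum.inl v ∈ Q := by
    by_contra hno
    push Not at hno
    refine hC.not_indep (hA.subset fun x hx => ?_)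
    rcases hJ x (hCJ hx) with h | h
    · exact h.1
    · exact absurd h (hno x hx)
  classical
  set K : N ⊕ N → Prop := fun x => ∃ v ∈ C, x = Sum.inl v ∧ Sum.inl v ∈ Q with hK
  have hKW {x : N ⊕ N} (h : K x) : x ∈ W := by
    obtain ⟨v, -, rfl, h⟩ := h
    exact hQ h
  -- Following `g` eventually runs around a cycle. Rotating the matching along it gives a second
  -- one, and the rotation is nontrivial because `g x ≠ x`.
  set f : N ⊕ N → N ⊕ N := fun x => if K x then g x else x with hf
  obtain ⟨ρ, hρ1, hρ2⟩ := exists_perm_eqOn_periodicPts f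
  have hρ (x : N ⊕ N) : ρ x = x ∨ (K x ∧ ρ x = g x) := by
    by_cases hx : x ∈ Function.periodicPts f
    · by_cases hKx : K x
      · exact Or.inr ⟨hKx, by rw [hρ1 x hx]; simp [hf, hKx]⟩
      · exact Or.inl (by rw [hρ1 x hx]; simp [hf, hKx])
    · exact Or.inl (hρ2 x hx)
  have hone := hr ρ
    (by
      intro x hx
      rcases hρ x with h | ⟨h, h'⟩
      · rwa [h]
      · rw [h']; exact hKW (hg1 x h))
    (by
      intro x hx
      rcases hρ x with h | ⟨h, -⟩
      · exact h
      · exact absurd (hKW h) hx)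
    (by
      intro x hx
      rcases hρ x with h | ⟨h, h'⟩
      · rw [h]; exact ha x hx
      · rw [h']; exact hg3 x h)
  obtain ⟨k, hk⟩ := exists_iterate_mem_periodicPts f (Sum.inl v)
  have hKk : K (f^[k] (Sum.inl v)) := by
    have : ∀ k, K (f^[k] (Sum.inl v)) := by
      intro k
      induction k with
      | zero => exact ⟨v, hvC, rfl, hvQ⟩
      | succ k ih =>
        rw [Function.iterate_succ_apply']
        simp only [hf] at ih ⊢
        rw [if_pos ih]
        exact hg1 _ ih
    exact this k
  have h1 := hρ1 _ hk
  rw [hone, Equiv.Perm.one_apply] at h1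
  refine hg2 _ hKk ?_
  conv_rhs => rw [h1]
  simp only [hf] at hKk ⊢
  rw [if_pos hKk]

/-- For two independent sets of two matroids there are common exchanges of at most `q` elements
that cover the elements of `B \ A` exactly `q n` times and those of `A \ B` at most `(q + 1) n`
times. -/
theorem exists_two_matroid_exchange {M₁ M₂ : Matroid N} (hE₁ : M₁.E = Set.univ)
    (hE₂ : M₂.E = Set.univ) {A B : Finset N}
    (hA₁ : M₁.Indep (A : Set N)) (hB₁ : M₁.Indep (B : Set N))
    (hA₂ : M₂.Indep (A : Set N)) (hB₂ : M₂.Indep (B : Set N)) (q : ℕ) :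
    ∃ (n : ℕ) (ι : Type) (_ : Fintype ι) (Y Z : ι → Finset N), 0 < n ∧
      (∀ i, Y i ⊆ B \ A ∧ (Y i).card ≤ q ∧ Z i ⊆ A \ B ∧ (Z i).card ≤ q + 1 ∧
        M₁.Indep (((A \ Z i) ∪ Y i : Finset N) : Set N) ∧
        M₂.Indep (((A \ Z i) ∪ Y i : Finset N) : Set N)) ∧
      (∀ v ∈ B \ A, (Finset.univ.filter fun i => v ∈ Y i).card = q * n) ∧
      ∀ u ∈ A \ B, (Finset.univ.filter fun i => u ∈ Z i).card ≤ (q + 1) * n := by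
  obtain ⟨a₀, ha₀⟩ := exists_paddedExchange_matching hA₁ hB₁
  obtain ⟨b₀, hb₀⟩ := exists_paddedExchange_matching hA₂ hB₂
  obtain ⟨n, ι, _, W, U, a, b, hn, h, hW, hU⟩ := exists_rigid_decomposition ha₀ hb₀
  set σ : ∀ i, Equiv.Perm {x // x ∈ W i} := fun i =>
    (Set.BijOn.equiv (a i) (h i).2.2.1.1).trans (Set.BijOn.equiv (b i) (h i).2.2.2.2.1.1).symm
    with hσ
  have hbσ (i) (x : {x // x ∈ W i}) : b i (σ i x) = a i x :=
    congrArg Subtype.val (Equiv.apply_symm_apply (Set.BijOn.equiv (b i) (h i).2.2.2.2.1.1)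
      (Set.BijOn.equiv (a i) (h i).2.2.1.1 x))
  choose m x₀ hwin1 hwin2 using fun i => exists_window_family (σ i) q
  set Q : (Σ i, Fin (m i)) → Finset (N ⊕ N) := fun z =>
    (window (σ z.1) q (x₀ z.1 z.2)).map (Function.Embedding.subtype _) with hQ
  have hQmem (z) (x : {x // x ∈ W z.1}) :
      (x : N ⊕ N) ∈ Q z ↔ x ∈ window (σ z.1) q (x₀ z.1 z.2) := by simp [hQ]
  have hQW (z) : Q z ⊆ W z.1 := by
    intro x hx
    obtain ⟨y, -, rfl⟩ := Finset.mem_map.1 hx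
    exact y.2
  have hWA (i) (v : N) (hv : Sum.inl v ∈ W i) : v ∉ A := by
    have := (h i).1 hv
    rw [Finset.inl_mem_disjSum] at this
    exact (Finset.mem_sdiff.1 this).2
  set R : (Σ i, Fin (m i)) → Finset (N ⊕ N) := fun z =>
    (Q z).image (a z.1) ∪ (Q z).image (b z.1) with hR
  have hRU (z) : R z ⊆ U z.1 := by
    refine Finset.union_subset ?_ ?_ <;> rw [Finset.image_subset_iff]
    · exact fun x hx => (h z.1).2.2.1.1.mapsTo (hQW z hx)
    · exact fun x hx => (h z.1).2.2.2.2.1.1.mapsTo (hQW z hx)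
  -- Since `a = b ∘ σ`, both images lie in the image under `b` of the window lengthened by one
  -- element.
  have hRcard (z) : (R z).card ≤ q + 1 := by
    have : R z ⊆ (window (σ z.1) (q + 1) (x₀ z.1 z.2)).image
        fun x : {x // x ∈ W z.1} => b z.1 x := by
      refine Finset.union_subset ?_ ?_
      · rw [Finset.image_subset_iff]
        intro x hx
        obtain ⟨y, hy, rfl⟩ := Finset.mem_map.1 hx
        obtain ⟨j, hj, rfl⟩ := mem_window.1 hy
        refine Finset.mem_image.2 ⟨σ z.1 ((σ z.1 ^ j) (x₀ z.1 z.2)),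
          mem_window.2 ⟨j + 1, Nat.succ_lt_succ hj, ?_⟩, hbσ _ _⟩
        rw [pow_succ', Equiv.Perm.mul_apply]
      · rw [Finset.image_subset_iff]
        intro x hx
        obtain ⟨y, hy, rfl⟩ := Finset.mem_map.1 hx
        obtain ⟨j, hj, rfl⟩ := mem_window.1 hy
        exact Finset.mem_image.2 ⟨_, mem_window.2 ⟨j, Nat.lt_succ_of_lt hj, rfl⟩, rfl⟩
    exact (Finset.card_le_card this).trans (Finset.card_image_le.trans (card_window_le _ _ _))
  set Y : (Σ i, Fin (m i)) → Finset N := fun z => Finset.univ.filter fun v => Sum.inl v ∈ Q z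
    with hY
  set Z : (Σ i, Fin (m i)) → Finset N := fun z => Finset.univ.filter fun u => Sum.inr u ∈ R z
    with hZ
  refine ⟨n * q.factorial, Σ i, Fin (m i), inferInstance, Y, Z,
    Nat.mul_pos hn q.factorial_pos, fun z => ⟨?_, ?_, ?_, ?_, ?_, ?_⟩, ?_, ?_⟩
  · intro v hv
    simp only [hY, Finset.mem_filter, Finset.mem_univ, true_and] at hv
    exact Finset.inl_mem_disjSum.1 ((h z.1).1 (hQW z hv))
  · refine (Finset.card_le_card_of_injOn (t := Q z) Sum.inl (fun v hv => ?_)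
      Sum.inl_injective.injOn).trans
      ((Finset.card_map _).le.trans (card_window_le (σ z.1) q (x₀ z.1 z.2)))
    simpa [hY] using hv
  · intro u hu
    simp only [hZ, Finset.mem_filter, Finset.mem_univ, true_and] at hu
    exact Finset.inr_mem_disjSum.1 ((h z.1).2.1 (hRU z hu))
  · refine (Finset.card_le_card_of_injOn Sum.inr (fun u hu => ?_) Sum.inr_injective.injOn).trans
      (hRcard z)
    simpa [hZ] using hu
  · refine indep_of_isRigid hE₁ hA₁ (h z.1).2.2.2.1 (hWA z.1) (h z.1).2.2.1.2 (hQW z) ?_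
    intro x hx
    simp only [hY, hZ, hR, Finset.mem_union, Finset.mem_sdiff, Finset.mem_filter, Finset.mem_univ,
      true_and] at hx ⊢
    tauto
  · refine indep_of_isRigid hE₂ hA₂ (h z.1).2.2.2.2.2 (hWA z.1) (h z.1).2.2.2.2.1.2 (hQW z) ?_
    intro x hx
    simp only [hY, hZ, hR, Finset.mem_union, Finset.mem_sdiff, Finset.mem_filter, Finset.mem_univ,
      true_and] at hx ⊢
    tauto
  · intro v hv
    have h1 := hW (Sum.inl v) (Finset.inl_mem_disjSum.2 hv)
    rw [Finset.card_filter, Fintype.sum_sigma]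
    simp only [← Finset.card_filter, hY, Finset.mem_filter, Finset.mem_univ, true_and]
    calc _ = ∑ i, if Sum.inl v ∈ W i then q * q.factorial else 0 := by
          refine Finset.sum_congr rfl fun i _ => ?_
          split_ifs with hi
          · rw [← hwin1 i ⟨_, hi⟩]
            congr 1
            ext j
            simpa using hQmem ⟨i, j⟩ ⟨_, hi⟩
          · exact Finset.card_eq_zero.2
              (Finset.filter_eq_empty_iff.2 fun j _ hj => hi (hQW ⟨i, j⟩ hj))
      _ = _ := by
          rw [← Finset.sum_filter, Finset.sum_const, h1, smul_eq_mul]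
          ring
  · intro u hu
    have h1 := hU (Sum.inr u) (Finset.inr_mem_disjSum.2 hu)
    rw [Finset.card_filter, Fintype.sum_sigma]
    simp only [← Finset.card_filter, hZ, Finset.mem_filter, Finset.mem_univ, true_and]
    calc _ ≤ ∑ i, if Sum.inr u ∈ U i then (q + 1) * q.factorial else 0 := by
          refine Finset.sum_le_sum fun i _ => ?_
          split_ifs with hi
          · obtain ⟨x, hx, hxu⟩ := (h i).2.2.1.1.surjOn hi
            set x' : {x // x ∈ W i} := ⟨x, hx⟩
            refine (Finset.card_le_card (t :=
              (Finset.univ.filter fun j => x' ∈ window (σ i) q (x₀ i j)) ∪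
              (Finset.univ.filter fun j => σ i x' ∈ window (σ i) q (x₀ i j) ∧
                x' ∉ window (σ i) q (x₀ i j))) fun j hj => ?_).trans
              ((Finset.card_union_le _ _).trans
                ((Nat.add_le_add (hwin1 i x').le (hwin2 i x')).trans_eq (by ring)))
            simp only [Finset.mem_filter, Finset.mem_univ, true_and, Finset.mem_union, hR,
              Finset.mem_image] at hj ⊢
            have hmem : x' ∈ window (σ i) q (x₀ i j) ∨ σ i x' ∈ window (σ i) q (x₀ i j) := by
              rcases hj with ⟨y, hy, hyu⟩ | ⟨y, hy, hyu⟩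
              · left
                rw [← hQmem ⟨i, j⟩]
                have hyx : y = x :=
                  (h i).2.2.1.1.injOn (hQW ⟨i, j⟩ hy) hx (hyu.trans hxu.symm)
                rwa [hyx] at hy
              · right
                rw [← hQmem ⟨i, j⟩]
                have hyx : y = σ i x' := (h i).2.2.2.2.1.1.injOn (hQW ⟨i, j⟩ hy) (σ i x').2
                  (hyu.trans (hxu.symm.trans (hbσ i x').symm))
                rwa [hyx] at hy
            tauto
          · exact (Finset.card_eq_zero.2
              (Finset.filter_eq_empty_iff.2 fun j _ hj => hi (hRU ⟨i, j⟩ hj))).le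
      _ = _ := by
          rw [← Finset.sum_filter, Finset.sum_const, h1, smul_eq_mul]
          ring

/-- Two matroids are treated jointly at cost `(q + 1) n`. Each of the other `p - 2` supplies
removals for the same sets `Y i` at cost `q n`, and the union of all removals is independent in
every matroid because independence passes to subsets. -/
theorem IsMatroidIntersection.exists_exchangeFamily {p q : ℕ} (hp : 2 ≤ p) (hq : 1 ≤ q)
    {I : Set (Finset N)} (hI : IsMatroidIntersection p I) {A B : Finset N} (hA : A ∈ I)
    (hB : B ∈ I) :
    ∃ n, 0 < n ∧ HasExchangeFamily (intersectionReachable p q I A) (2 * p * (q + 1)) (q * n)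
      ((p * q + 1 - q) * n) A B := by
  classical
  obtain ⟨-, M, hE, hM⟩ := hI
  have hAi := (hM A).1 hA
  have hBi := (hM B).1 hB
  set c₀ : Fin p := ⟨0, by omega⟩
  set c₁ : Fin p := ⟨1, by omega⟩
  have hc : c₀ ≠ c₁ := by simp [c₀, c₁]
  obtain ⟨n, ι, _, Y, Z₀, hn, h₀, hY, hZ₀⟩ := exists_two_matroid_exchange (hE c₀) (hE c₁)
    (hAi c₀) (hBi c₀) (hAi c₁) (hBi c₁) q
  choose Z hZ hZu using fun c => exists_rota_exchange (hAi c) (hBi c) Y (fun i => (h₀ i).1) hY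
  set R : Finset (Fin p) := Finset.univ \ {c₀, c₁} with hR
  have hRcard : R.card = p - 2 := by
    rw [hR, Finset.card_sdiff_of_subset (Finset.subset_univ _), Finset.card_pair hc,
      Finset.card_univ, Fintype.card_fin]
  obtain ⟨r, rfl⟩ := Nat.exists_eq_add_of_le hp
  have hRr : R.card = r := by omega
  set T : ι → Finset N := fun i => Z₀ i ∪ R.biUnion fun c => Z c i with hT
  have hTAB (i) : T i ⊆ A \ B :=
    Finset.union_subset (h₀ i).2.2.1 (Finset.biUnion_subset.2 fun c _ => (hZ c i).1)
  have hTA (i) : T i ⊆ A := (hTAB i).trans Finset.sdiff_subset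
  have hYA (i) : Disjoint (Y i) A :=
    Finset.disjoint_of_subset_left (h₀ i).1 Finset.sdiff_disjoint
  have hTcard (i) : (T i).card ≤ q + 1 + r * q := by
    refine (Finset.card_union_le _ _).trans (Nat.add_le_add (h₀ i).2.2.2.1 ?_)
    exact (Finset.card_biUnion_le_card_mul _ _ _
      fun c _ => (hZ c i).2.1.trans (h₀ i).2.1).trans_eq (by rw [hRr])
  refine ⟨n, hn, Fintype.card ι, fun j => Y ((Fintype.equivFin ι).symm j) ∪
    T ((Fintype.equivFin ι).symm j), fun j => ?_, fun v hv => ?_, fun u hu => ?_⟩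
  · dsimp only
    generalize (Fintype.equivFin ι).symm j = i
    have hYc := (h₀ i).2.1
    have hTc := hTcard i
    refine ⟨?_, ?_, ?_⟩
    · refine Finset.union_subset ((h₀ i).1.trans fun x hx => ?_) ((hTAB i).trans fun x hx => ?_)
      · exact Finset.mem_symmDiff.2 (Or.inr (Finset.mem_sdiff.1 hx))
      · exact Finset.mem_symmDiff.2 (Or.inl (Finset.mem_sdiff.1 hx))
    · refine (Finset.card_union_le _ _).trans ?_
      nlinarith
    · rw [symmDiff_union_eq (hYA i) (hTA i)]
      refine ⟨(hM _).2 fun c => ?_, ?_, ?_⟩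
      · have hsub : ∀ Z' ⊆ T i, A \ T i ∪ Y i ⊆ A \ Z' ∪ Y i := fun Z' h =>
          Finset.union_subset_union_left (Finset.sdiff_subset_sdiff subset_rfl h)
        by_cases h0 : c = c₀
        · rw [h0]
          exact (h₀ i).2.2.2.2.1.subset
            (Finset.coe_subset.2 (hsub _ Finset.subset_union_left))
        by_cases h1 : c = c₁
        · rw [h1]
          exact (h₀ i).2.2.2.2.2.subset
            (Finset.coe_subset.2 (hsub _ Finset.subset_union_left))
        · refine (hZ c i).2.2.subset (Finset.coe_subset.2 (hsub _ ?_))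
          refine (Finset.subset_biUnion_of_mem (fun c => Z c i) ?_).trans
            Finset.subset_union_right
          simp [hR, h0, h1]
      · rw [union_sdiff_sdiff_eq (hYA i)]
        omega
      · rw [sdiff_union_sdiff_eq (hYA i) (hTA i)]
        nlinarith
  · rw [← hY v hv, Finset.card_filter, Finset.card_filter,
      Fintype.sum_equiv (Fintype.equivFin ι).symm _ (fun i => if v ∈ Y i ∪ T i then 1 else 0)
      (fun j => rfl)]
    refine Finset.sum_congr rfl fun i _ => ?_
    have : v ∉ T i := fun h => (Finset.mem_sdiff.1 hv).2 (hTA i h)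
    simp [this]
  · rw [Finset.card_filter,
      Fintype.sum_equiv (Fintype.equivFin ι).symm _ (fun i => if u ∈ Y i ∪ T i then 1 else 0)
      (fun j => rfl), ← Finset.card_filter]
    calc _ ≤ ((Finset.univ.filter fun i => u ∈ Z₀ i) ∪
          R.biUnion fun c => Finset.univ.filter fun i => u ∈ Z c i).card := by
          refine Finset.card_le_card fun i hi => ?_
          have hYu : u ∉ Y i := fun h =>
            (Finset.mem_sdiff.1 ((h₀ i).1 h)).2 (Finset.mem_sdiff.1 hu).1
          simpa [hT, hYu] using hi
      _ ≤ (q + 1) * n + r * (q * n) := by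
          refine (Finset.card_union_le _ _).trans (Nat.add_le_add (hZ₀ u hu) ?_)
          exact (Finset.card_biUnion_le_card_mul _ _ _ fun c _ => hZu c u).trans_eq (by rw [hRr])
      _ = _ := by
          have : (2 + r) * q + 1 - q = q + 1 + r * q := by
            have : (2 + r) * q = q + q + r * q := by ring
            omega
          rw [this]
          ring

end MatroidExchange

theorem mainTheorem3 {N : Type*} [Fintype N] [DecidableEq N]
    (I : Set (Finset N)) (p q s t : ℕ) (hp : 2 ≤ p) (hq : 1 ≤ q)
    (F : Finset N → Set (Finset N))
    (hcase :
      (IsMatroidIntersection p I ∧ F = intersectionReachable p q I ∧ t = 2 * p * (q + 1)) ∨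
      (IsExchangeSystem p I ∧ F = exchangeReachable p q I ∧ t = p * q + 1))
    (hs : IsGreatest (Finset.card '' I) s)
    (f : Finset N → ℝ) (hnonneg : ∀ X, 0 ≤ f X) (hmono : ∀ X Y : Finset N, X ⊆ Y → f X ≤ f Y)
    (α β₁ β₂ : ℝ) (hα : 0 ≤ α) (hβ₁ : 0 ≤ β₁) (hβ₂ : 0 ≤ β₂)
    (hloc : IsLocalizable f α β₁ β₂ s t)
    (X₀ : Finset N) (hX₀ : X₀ ∈ I)
    (Xopt : Finset N) (hopt : IsMaximizer f I Xopt) :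
    (∀ (T : ℕ) (X : Finset N) (e : SearchExit), LocalSearch f F T X₀ X e →
      α * (1 - Real.exp (-((β₁ * ((p : ℝ) - 1 + 1 / (q : ℝ)) + β₂) * (T : ℝ) / (s : ℝ)))) /
          (β₁ * ((p : ℝ) - 1 + 1 / (q : ℝ)) + β₂) * f Xopt ≤ f X) ∧
    (∀ (T : ℕ) (X : Finset N), LocalSearch f F T X₀ X SearchExit.noImprovement →
      α / (β₁ * ((p : ℝ) - 1 + 1 / (q : ℝ)) + β₂) * f Xopt ≤ f X) := by
  have hsI : ∀ X ∈ I, X.card ≤ s := fun X hX => hs.2 ⟨X, hX, rfl⟩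
  rcases hcase with ⟨hI, rfl, rfl⟩ | ⟨hI, rfl, rfl⟩
  · exact localSearch_guarantee_of_exchange (F := intersectionReachable p q I) hp hq
      (fun X _ Y hY => hY.1) (fun X hX => ⟨hX, by simp, by simp⟩) hsI
      (fun A hA B hB => hI.exists_exchangeFamily hp hq hA hB)
      hnonneg hα hβ₁ hβ₂ hloc hX₀ hopt.1
  · have hqp : q ≤ p * q := Nat.le_mul_of_pos_left q (by omega)
    exact localSearch_guarantee_of_exchange (F := exchangeReachable p q I) hp hq
      (fun X _ Y hY => hY.1) (fun X hX => ⟨hX, by simp, by simp; omega⟩) hsI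
      (fun A hA B hB => ⟨_, q.factorial_pos, hI.hasExchangeFamily q hp hA hB⟩)
      hnonneg hα hβ₁ hβ₂ hloc hX₀ hopt.1
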